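/- Let $\hbar,m>0$ and let $V:\mathbb R\to\mathbb R$ be continuously differentiable with $V'$ of at most polynomial growth; put $H(p,x)=\frac{p^2}{2m}+V(x)$. For a wave function $\psi$ in the Schwartz space $\mathcal S(\mathbb R)$ let $$P(p,x)=\frac1{2\pi\hbar}\int\psi^*\!\left(x-\tfrac y2\right)\psi\!\left(x+\tfrac y2\right)e^{-ipy/\hbar}\,dy$$ be its Wigner function, with Wigner flow $\mathcal J_p=-P\odot\partial_xH$, $\mathcal J_x=P\odot\partial_pH\;(=\frac pmP)$, where $\odot=\operatorname{sinc}\big(\frac\hbar2(\overleftarrow{\partial_x}\overrightarrow{\partial_p}-\overleftarrow{\partial_p}\overrightarrow{\partial_x})\big)$ is understood by Fourier transformation of the left factor: for $f(p,x)=e^{i(\xi p+\eta x)}$ it is $f\odot b=f\cdot\frac12\int_{-1}^1b\big(p-\frac{s\hbar\eta}2,x+\frac{s\hbar\xi}2\big)ds$. For $\sigma_p,\sigma_x>0$ let $K$ denote convolution on phase space with the Gaussian kernel $\frac1{2\pi\sigma_p\sigma_x}e^{-\delta p^2/2\sigma_p^2-\delta x^2/2\sigma_x^2}$. Let $Q=KP$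 be the generalized Husimi function and $K\mathcal J_p$, $K\mathcal J_x$ the Husimi flow in the default gauge. The regularized Bohmian momentum and the regularized Bohmian gauge potential are $$\tilde p_B(x)=\frac{\int K(pP)(p,x)\,dp}{\int Q(p,x)\,dp},\qquad A(p,x)=\frac1m\left(\tilde p_B(x)\int_{-\infty}^pQ(q,x)\,dq-\int_{-\infty}^pK(pP)(q,x)\,dq\right),$$ and the Husimi flow in this gauge is $J_p=K\mathcal J_p-\partial_xA$, $J_x=K\mathcal J_x+\partial_pA$. (i) This flow represents the evolution of the fluid: if $t\mapsto\psi(\cdot,t)$ is a continuous $\mathcal S(\mathbb R)$-valued curve on an open set of times which satisfies $i\hbar\,\partial_t\psi=-\frac{\hbar^2}{2m}\partial_x^2\psi+V\psi$ pointwise, then for all $\sigma_p,\sigma_x>0$ the derivatives in the following equation exist, and $\partial_tQ=-\partial_pJ_p-\partial_xJ_x$. (ii) Let $\psi\in\mathcal S(\mathbb R)$. In the singular limit $\sigma_x\to0^+$, $\sigma_p\to+\infty$ (taken jointly), for every $p$ and every $x$ with $\psi(x)\neq0$, $$\sqrt{2\pi}\,\sigma_p\,Q(p,x)\to|\psi(x)|^2,\qquad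 \tilde p_B(x)\to p_B(x),$$ and the flow becomes $J_x=\frac{p_B(x)}mQ$, $J_p=-\partial_x\big(V(x)+V_B(x)\big)Q$, in the sense that $$\frac{J_x(p,x)}{Q(p,x)}\to\frac{p_B(x)}m,\qquad\frac{J_p(p,x)}{Q(p,x)}\to-\frac{\partial}{\partial x}\big(V(x)+V_B(x)\big),$$ where $p_B(x)=\operatorname{Re}\frac{-i\hbar\,\psi'(x)}{\psi(x)}$ is the Bohmian momentum and $V_B(x)=-\frac{\hbar^2}{2m|\psi(x)|}\frac{\partial^2}{\partial x^2}|\psi(x)|$ is the quantum potential. -/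

import Mathlib

open Filter Topology

noncomputable section

namespace HusimiFluid

/-- The Wigner function of the pure state `ψ`,
`P(p,x) = (2πℏ)⁻¹ ∫ ψ*(x - y/2) ψ(x + y/2) exp(-i p y / ℏ) dy`.
The integral is always a real number (substitute `y ↦ -y`), so `re` only changes its type. -/
def wigner (hbar : ℝ) (ψ : ℝ → ℂ) (p x : ℝ) : ℝ :=
  (1 / (2 * Real.pi * hbar)) *
    (∫ y : ℝ, starRingEnd ℂ (ψ (x - y / 2)) * ψ (x + y / 2) *
      Complex.exp (-Complex.I * ((p * y / hbar : ℝ) : ℂ))).re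

/-- The Weyl symbol `H(p,x) = p² / (2m) + V(x)` of the Hamiltonian. -/
def weylHamiltonian (m : ℝ) (V : ℝ → ℝ) (p x : ℝ) : ℝ :=
  p ^ 2 / (2 * m) + V x

/-- The Fourier transform of a phase-space function,
`∫∫ f(p,x) exp(-i (ξ p + η x)) dp dx`. -/
def phaseFourier (f : ℝ → ℝ → ℝ) (ξ η : ℝ) : ℂ :=
  ∫ x : ℝ, ∫ p : ℝ,
    (f p x : ℂ) * Complex.exp (-Complex.I * ((ξ * p + η * x : ℝ) : ℂ))

/-- The binary operation `f sinc((ℏ/2)(←∂ₓ →∂ₚ - ←∂ₚ →∂ₓ)) b`.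
On a plane wave `exp(i (ξ p + η x))` the derivatives acting to the left become `←∂ₚ = iξ` and
`←∂ₓ = iη`; then, because `sinc z = (1/2) ∫_{-1}^{1} exp(i s z) ds`, the operator acting on `b` is
the average of the translations `exp(-(s ℏ / 2)(η ∂ₚ - ξ ∂ₓ))`, that is
`(1/2) ∫_{-1}^{1} b(p - s ℏ η / 2, x + s ℏ ξ / 2) ds`. The operation is extended from plane waves to
all `f` by Fourier inversion. (For `b` polynomial and `f` a Schwartz function this is the finite
sum that the power series of `sinc` gives.) The result is real for real `f` and `b`. -/
def sincProduct (hbar : ℝ) (f b : ℝ → ℝ → ℝ) (p x : ℝ) : ℝ :=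
  (1 / (2 * Real.pi) ^ 2) *
    (∫ ξ : ℝ, ∫ η : ℝ,
      phaseFourier f ξ η * Complex.exp (Complex.I * ((ξ * p + η * x : ℝ) : ℂ)) *
        (((1 / 2) * ∫ s in (-1 : ℝ)..1,
          b (p - s * hbar * η / 2) (x + s * hbar * ξ / 2) : ℝ) : ℂ)).re

/-- Momentum component of the Wigner flow, `-P sinc(…) ∂H/∂x`. -/
def wignerFlowP (hbar m : ℝ) (V : ℝ → ℝ) (ψ : ℝ → ℂ) (p x : ℝ) : ℝ :=
  -sincProduct hbar (wigner hbar ψ)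
    (fun p' x' => deriv (fun z => weylHamiltonian m V p' z) x') p x

/-- Position component of the Wigner flow, `P sinc(…) ∂H/∂p`. -/
def wignerFlowX (hbar m : ℝ) (V : ℝ → ℝ) (ψ : ℝ → ℂ) (p x : ℝ) : ℝ :=
  sincProduct hbar (wigner hbar ψ)
    (fun p' x' => deriv (fun z => weylHamiltonian m V z x') p') p x

/-- The Gaussian kernel with widths `σp`, `σx`. -/
def husimiKernel (σp σx δp δx : ℝ) : ℝ :=
  1 / (2 * Real.pi * σp * σx) *
    Real.exp (-(δp ^ 2 / (2 * σp ^ 2)) - δx ^ 2 / (2 * σx ^ 2))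

/-- Convolution of a phase-space function with the Gaussian kernel. -/
def smooth (σp σx : ℝ) (f : ℝ → ℝ → ℝ) (p x : ℝ) : ℝ :=
  ∫ x' : ℝ, ∫ p' : ℝ, f p' x' * husimiKernel σp σx (p - p') (x - x')

/-- The generalized Husimi function `Q`. -/
def husimi (hbar σp σx : ℝ) (ψ : ℝ → ℂ) : ℝ → ℝ → ℝ :=
  smooth σp σx (wigner hbar ψ)

/-- Momentum component of the Husimi flow in the default gauge. -/
def husimiFlowP (hbar m σp σx : ℝ) (V : ℝ → ℝ) (ψ : ℝ → ℂ) : ℝ → ℝ → ℝ :=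
  smooth σp σx (wignerFlowP hbar m V ψ)

/-- Position component of the Husimi flow in the default gauge. -/
def husimiFlowX (hbar m σp σx : ℝ) (V : ℝ → ℝ) (ψ : ℝ → ℂ) : ℝ → ℝ → ℝ :=
  smooth σp σx (wignerFlowX hbar m V ψ)

/-- The smoothed first-moment density: the Gaussian convolution of `p P(p,x)`. -/
def smoothMomentum (hbar σp σx : ℝ) (ψ : ℝ → ℂ) : ℝ → ℝ → ℝ :=
  smooth σp σx (fun p' x' => p' * wigner hbar ψ p' x')

/-- The regularized Bohmian momentum, a function of the position only. -/
def regBohmianMomentum (hbar σp σx : ℝ) (ψ : ℝ → ℂ) (x : ℝ) : ℝ :=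
  (∫ p : ℝ, smoothMomentum hbar σp σx ψ p x) / ∫ p : ℝ, husimi hbar σp σx ψ p x

/-- The regularized Bohmian gauge potential. -/
def bohmianGauge (hbar m σp σx : ℝ) (ψ : ℝ → ℂ) (p x : ℝ) : ℝ :=
  (1 / m) *
    (regBohmianMomentum hbar σp σx ψ x * (∫ q in Set.Iic p, husimi hbar σp σx ψ q x) -
      ∫ q in Set.Iic p, smoothMomentum hbar σp σx ψ q x)

/-- Momentum component of the Husimi flow in the regularized Bohmian gauge: the default flow
plus `-∂/∂x` of the gauge potential. -/
def bohmianFlowP (hbar m σp σx : ℝ) (V : ℝ → ℝ) (ψ : ℝ → ℂ) (p x : ℝ) : ℝ :=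
  husimiFlowP hbar m σp σx V ψ p x
    + -deriv (fun x' => bohmianGauge hbar m σp σx ψ p x') x

/-- Position component of the Husimi flow in the regularized Bohmian gauge: the default flow
plus `∂/∂p` of the gauge potential. -/
def bohmianFlowX (hbar m σp σx : ℝ) (V : ℝ → ℝ) (ψ : ℝ → ℂ) (p x : ℝ) : ℝ :=
  husimiFlowX hbar m σp σx V ψ p x
    + deriv (fun p' => bohmianGauge hbar m σp σx ψ p' x) p

/-- The Bohmian momentum `Re[(-iℏ ψ'(x)) / ψ(x)]`. -/
def bohmianMomentum (hbar : ℝ) (ψ : ℝ → ℂ) (x : ℝ) : ℝ :=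
  (-Complex.I * (hbar : ℂ) * deriv ψ x / ψ x).re

/-- The quantum potential `-ℏ² / (2 m |ψ|) ∂²|ψ|/∂x²`. -/
def quantumPotential (hbar m : ℝ) (ψ : ℝ → ℂ) (x : ℝ) : ℝ :=
  -(hbar ^ 2 / (2 * m * ‖ψ x‖)) * iteratedDeriv 2 (fun z => ‖ψ z‖) x

/-- The Schrödinger operator, `-ℏ²/(2m) ψ'' + V ψ`. -/
def hamiltonian (hbar m : ℝ) (V : ℝ → ℝ) (ψ : ℝ → ℂ) (x : ℝ) : ℂ :=
  -((hbar ^ 2 / (2 * m) : ℝ) : ℂ) * iteratedDeriv 2 ψ x + (V x : ℂ) * ψ x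

/-- The limit `σp → +∞`, `σx → 0⁺` (jointly, without any relation between the two rates);
the pairs are `(σp, σx)`. -/
def bohmianLimit : Filter (ℝ × ℝ) := atTop ×ˢ 𝓝[>] (0 : ℝ)

end HusimiFluid

end

open HusimiFluid

/-! The Wigner function is the Fourier transform in `y` of the off-diagonal density ρ(x,y) = ψ*(x -
y/2) ψ(x + y/2), and the theorem is easiest to see in that picture. Multiplication by p becomes -iℏ
∂_y, which moves derivatives onto the wave functions (`momentum_mul_crossWigner`). The sinc product
becomes multiplication of ρ by a function of (x,y) (`sincProduct_wigner`): the Wigner flow has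
position component pP/m, and its momentum component is the transform of -ρ times the mean of V' over
the segment from x - y/2 to x + y/2.

(i) Times y, that mean is V(x + y/2) - V(x - y/2), so the momentum divergence of the Wigner flow is
the potential part of the commutator with the Hamiltonian; the kinetic part gives ∂_x(pP)/m.
Smoothing preserves this balance, and the gauge terms cancel in the divergence. The analytic
difficulty is that V is only C¹: Vψ need not be Schwartz, and the momentum component of the flow
need not decay rapidly in p. Such terms are handled through `smooth_re_partialFourier`, which turns
the convolution into an expectation over two standard Gaussians of a bounded kernel in (x,y).

(ii) A Gaussian of large width σp centred at q gives (-∞, p] the mass 1/2 + (√(2π) σp)⁻¹ (p - q +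
o(1)). In ∂_x A the contributions of 1/2 cancel, since the regularized Bohmian momentum is the
quotient of the two smoothed marginals. The remainder has the same order as Q, and its limit
involves only the momentum moments n = |ψ|², j, s of P of orders 0, 1, 2. Thus √(2π) σp J_p tends to
-n V' - (1/m) ∂_x(s - j²/n), and for a pure state the gradient of the dispersion s - j²/n is m n
times the derivative of the quantum potential (`quantum_force_identity`). The position component J_x
equals the regularized Bohmian momentum times Q/m already before the limit (`bohmianFlowX_eq`). -/

noncomputable section

namespace HusimiFluid

open MeasureTheory ProbabilityTheory Set SchwartzMap

/-! ### Gaussian densities and rescaling to the standard Gaussian measure -/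

/-- The centred Gaussian density of width `σ`. -/
def gaussDensity (σ u : ℝ) : ℝ :=
  (Real.sqrt (2 * Real.pi) * σ)⁻¹ * Real.exp (-(u ^ 2 / (2 * σ ^ 2)))

/-- The standard Gaussian measure. -/
abbrev stdGauss : Measure ℝ := gaussianReal 0 1

lemma sqrt_two_pi_pos : 0 < Real.sqrt (2 * Real.pi) := by positivity

lemma husimiKernel_eq (σp σx a b : ℝ) :
    husimiKernel σp σx a b = gaussDensity σp a * gaussDensity σx b := by
  have h : Real.sqrt (2 * Real.pi) * Real.sqrt (2 * Real.pi) = 2 * Real.pi :=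
    Real.mul_self_sqrt (by positivity)
  have e : Real.exp (-(a ^ 2 / (2 * σp ^ 2)) - b ^ 2 / (2 * σx ^ 2)) =
      Real.exp (-(a ^ 2 / (2 * σp ^ 2))) * Real.exp (-(b ^ 2 / (2 * σx ^ 2))) := by
    rw [← Real.exp_add]; ring_nf
  unfold husimiKernel gaussDensity
  rw [e, one_div, show 2 * Real.pi * σp * σx =
    (Real.sqrt (2 * Real.pi) * σp) * (Real.sqrt (2 * Real.pi) * σx) by
      linear_combination (-σp * σx) * h, mul_inv]
  ring

@[fun_prop]
lemma continuous_gaussDensity (σ : ℝ) : Continuous (gaussDensity σ) := by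
  unfold gaussDensity; fun_prop

lemma gaussDensity_nonneg {σ : ℝ} (hσ : 0 < σ) (u : ℝ) : 0 ≤ gaussDensity σ u := by
  unfold gaussDensity; positivity

lemma gaussDensity_le {σ : ℝ} (hσ : 0 < σ) (u : ℝ) :
    gaussDensity σ u ≤ (Real.sqrt (2 * Real.pi) * σ)⁻¹ := by
  unfold gaussDensity
  refine mul_le_of_le_one_right (by positivity) (Real.exp_le_one_iff.2 ?_)
  have : 0 ≤ u ^ 2 / (2 * σ ^ 2) := by positivity
  linarith

lemma gaussDensity_neg (σ u : ℝ) : gaussDensity σ (-u) = gaussDensity σ u := by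
  simp [gaussDensity]

lemma gaussDensity_sub_comm (σ u v : ℝ) : gaussDensity σ (u - v) = gaussDensity σ (v - u) := by
  rw [← gaussDensity_neg, neg_sub]

lemma gaussDensity_eq_pdf {σ : ℝ} (hσ : 0 < σ) :
    gaussDensity σ = gaussianPDFReal 0 (σ ^ 2).toNNReal := by
  ext u
  simp only [gaussDensity, gaussianPDFReal_def, Real.coe_toNNReal _ (sq_nonneg σ)]
  rw [Real.sqrt_mul (x := 2 * Real.pi) (by positivity), Real.sqrt_sq hσ.le, sub_zero, neg_div]

lemma integrable_gaussDensity {σ : ℝ} (hσ : 0 < σ) : Integrable (gaussDensity σ) := by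
  rw [gaussDensity_eq_pdf hσ]; exact integrable_gaussianPDFReal _ _

lemma integral_gaussDensity {σ : ℝ} (hσ : 0 < σ) : ∫ u, gaussDensity σ u = 1 := by
  rw [gaussDensity_eq_pdf hσ]
  refine integral_gaussianPDFReal_eq_one _ ?_
  simpa using hσ.ne'

lemma integral_stdGauss {E : Type*} [NormedAddCommGroup E] [NormedSpace ℝ E] (f : ℝ → E) :
    ∫ z, f z ∂stdGauss = ∫ z, gaussDensity 1 z • f z := by
  rw [integral_gaussianReal_eq_integral_smul one_ne_zero, gaussDensity_eq_pdf one_pos]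
  simp

lemma integral_gaussDensity_smul {E : Type*} [NormedAddCommGroup E] [NormedSpace ℝ E]
    {σ : ℝ} (hσ : 0 < σ) (f : ℝ → E) :
    ∫ u, gaussDensity σ u • f u = ∫ z, f (σ * z) ∂stdGauss := by
  rw [integral_stdGauss]
  have h := Measure.integral_comp_mul_left (fun u => gaussDensity σ u • f u) σ
  have h2 : ∀ z, gaussDensity 1 z • f (σ * z) = σ • (gaussDensity σ (σ * z) • f (σ * z)) := by
    intro z
    rw [smul_smul]
    congr 1
    simp only [gaussDensity]
    rw [show (σ * z) ^ 2 / (2 * σ ^ 2) = z ^ 2 / (2 * 1 ^ 2) by field_simp, mul_one, mul_inv]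
    field_simp
  simp_rw [h2]
  rw [integral_smul, h, smul_smul, abs_of_pos (inv_pos.2 hσ), mul_inv_cancel₀ hσ.ne', one_smul]

/-! ### Rapidly decaying phase-space functions and their Gaussian averages -/

/-- Jointly continuous functions of `(p, x)` that decay in `p` faster than any power, uniformly
in `x`. -/
structure RapidDecay (f : ℝ → ℝ → ℝ) : Prop where
  cont : Continuous (Function.uncurry f)
  bound : ∀ j : ℕ, ∃ C : ℝ, ∀ p x, |p| ^ j * |f p x| ≤ C

/-- Expanding (1 + |p|)(1 + p²) uses exactly the powers 0 to 3. The factor 1 + |p| pays for a kernel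
of linear growth and (1 + p²)⁻¹ remains as an integrable majorant, independent of x. -/
lemma RapidDecay.exists_weight_bound {f : ℝ → ℝ → ℝ} (hf : RapidDecay f) :
    ∃ C : ℝ, 0 ≤ C ∧ ∀ p x, (1 + |p|) * |f p x| ≤ C * (1 + p ^ 2)⁻¹ := by
  obtain ⟨C0, h0⟩ := hf.bound 0
  obtain ⟨C1, h1⟩ := hf.bound 1
  obtain ⟨C2, h2⟩ := hf.bound 2
  obtain ⟨C3, h3⟩ := hf.bound 3
  have key : ∀ p x, (1 + |p|) * |f p x| * (1 + p ^ 2) ≤ C0 + C1 + C2 + C3 := by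
    intro p x
    have := h0 p x
    have := h1 p x
    have := h2 p x
    have := h3 p x
    rw [← sq_abs p]
    nlinarith
  refine ⟨C0 + C1 + C2 + C3, le_trans (by positivity) (key 0 0), fun p x => ?_⟩
  rw [← div_eq_mul_inv, le_div_iff₀ (by positivity)]
  exact key p x

lemma RapidDecay.momentum_mul {f : ℝ → ℝ → ℝ} (hf : RapidDecay f) :
    RapidDecay (fun p x => p * f p x) where
  cont := by
    have := hf.cont
    exact continuous_fst.mul this
  bound j := by
    obtain ⟨C, hC⟩ := hf.bound (j + 1)
    refine ⟨C, fun p x => ?_⟩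
    have := hC p x
    rw [abs_mul, ← mul_assoc, ← pow_succ]
    exact this

/-- Kernels in the momentum variable of at most linear growth. -/
def LinearGrowth (k : ℝ → ℝ) : Prop :=
  Measurable k ∧ ∃ c, 0 ≤ c ∧ ∀ q, |k q| ≤ c * (1 + |q|)

lemma LinearGrowth.of_bounded {k : ℝ → ℝ} (hk : Measurable k) {c : ℝ} (h : ∀ q, |k q| ≤ c) :
    LinearGrowth k := by
  have hc : 0 ≤ c := (abs_nonneg _).trans (h 0)
  refine ⟨hk, c, hc, fun q => (h q).trans ?_⟩
  have := abs_nonneg q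
  nlinarith

/-- The integral of `f(q, x - σ z)` against `k(q)` in `q` and a standard Gaussian in `z`. -/
def gaussAvg (σ : ℝ) (k : ℝ → ℝ) (f : ℝ → ℝ → ℝ) (x : ℝ) : ℝ :=
  ∫ z : ℝ × ℝ, k z.1 * f z.1 (x - σ * z.2) ∂(volume.prod stdGauss)

lemma integrable_inv_one_add_sq_fst :
    Integrable (fun z : ℝ × ℝ => (1 + z.1 ^ 2)⁻¹) (volume.prod stdGauss) :=
  integrable_inv_one_add_sq.comp_fst _

section

variable {k : ℝ → ℝ} {f g : ℝ → ℝ → ℝ}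

lemma measurable_avg_integrand (hk : Measurable k) (hf : RapidDecay f) (σ x : ℝ) :
    Measurable (fun z : ℝ × ℝ => k z.1 * f z.1 (x - σ * z.2)) := by
  refine (hk.comp measurable_fst).mul ?_
  have h : Continuous fun z : ℝ × ℝ => Function.uncurry f (z.1, x - σ * z.2) :=
    hf.cont.comp (by fun_prop)
  exact h.measurable

lemma avg_integrand_bound {c C : ℝ} (hc0 : 0 ≤ c) (hc : ∀ q, |k q| ≤ c * (1 + |q|))
    (hC : ∀ p x, (1 + |p|) * |f p x| ≤ C * (1 + p ^ 2)⁻¹) (q y : ℝ) :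
    ‖k q * f q y‖ ≤ c * C * (1 + q ^ 2)⁻¹ := by
  rw [norm_mul, Real.norm_eq_abs, Real.norm_eq_abs]
  calc |k q| * |f q y| ≤ c * (1 + |q|) * |f q y| := by gcongr; exact hc q
    _ = c * ((1 + |q|) * |f q y|) := by ring
    _ ≤ c * (C * (1 + q ^ 2)⁻¹) := by exact mul_le_mul_of_nonneg_left (hC q y) hc0
    _ = _ := by ring

lemma integrable_avg_integrand (hk : LinearGrowth k) (hf : RapidDecay f) (σ x : ℝ) :
    Integrable (fun z : ℝ × ℝ => k z.1 * f z.1 (x - σ * z.2)) (volume.prod stdGauss) := by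
  obtain ⟨hkm, c, hc0, hc⟩ := hk
  obtain ⟨C, hC0, hC⟩ := hf.exists_weight_bound
  refine (integrable_inv_one_add_sq_fst.const_mul (c * C)).mono'
    (measurable_avg_integrand hkm hf σ x).aestronglyMeasurable (ae_of_all _ fun z => ?_)
  exact avg_integrand_bound hc0 hc hC _ _

lemma RapidDecay.integrable_mul (hk : LinearGrowth k) (hf : RapidDecay f) (x : ℝ) :
    Integrable (fun q => k q * f q x) := by
  obtain ⟨hkm, c, hc0, hc⟩ := hk
  obtain ⟨C, hC0, hC⟩ := hf.exists_weight_bound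
  refine (integrable_inv_one_add_sq.const_mul (c * C)).mono' ?_ (ae_of_all _ fun z => ?_)
  · have h : Continuous fun q => Function.uncurry f (q, x) := hf.cont.comp (by fun_prop)
    exact (hkm.mul h.measurable).aestronglyMeasurable
  · exact avg_integrand_bound hc0 hc hC _ _

lemma RapidDecay.integrable (hf : RapidDecay f) (x : ℝ) : Integrable (fun q => f q x) := by
  have := hf.integrable_mul (k := fun _ => 1)
    (LinearGrowth.of_bounded measurable_const (c := 1) (by simp)) x
  simpa using this

lemma gaussAvg_eq_iterated (hk : LinearGrowth k) (hf : RapidDecay f) (σ x : ℝ) :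
    gaussAvg σ k f x = ∫ z, (∫ q, k q * f q (x - σ * z)) ∂stdGauss := by
  unfold gaussAvg
  rw [integral_prod_symm _ (integrable_avg_integrand hk hf σ x)]

/-- Rescaling the position variable moves `σx` from the measure into the argument of `f`. Position
derivatives then fall on `f`, and `σx → 0` becomes a dominated convergence over a fixed measure. -/
lemma smooth_eq_gaussAvg {σp σx : ℝ} (hp : 0 < σp) (hx : 0 < σx) (hf : RapidDecay f) (p x : ℝ) :
    smooth σp σx f p x = gaussAvg σx (fun q => gaussDensity σp (p - q)) f x := by
  have hk : LinearGrowth (fun q => gaussDensity σp (p - q)) :=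
    LinearGrowth.of_bounded (by fun_prop) (c := (Real.sqrt (2 * Real.pi) * σp)⁻¹) fun q => by
      rw [abs_of_nonneg (gaussDensity_nonneg hp _)]; exact gaussDensity_le hp _
  rw [gaussAvg_eq_iterated hk hf, ← integral_gaussDensity_smul hx
    (fun u => ∫ q, gaussDensity σp (p - q) * f q (x - u))]
  unfold smooth
  rw [← integral_sub_left_eq_self _ volume x]
  congr 1 with u
  rw [smul_eq_mul, ← integral_const_mul]
  congr 1 with q
  rw [husimiKernel_eq]
  simp only [sub_sub_cancel]
  ring

lemma hasDerivAt_gaussAvg (hk : LinearGrowth k) (hf : RapidDecay f) (hg : RapidDecay g)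
    (hd : ∀ p x, HasDerivAt (f p) (g p x) x) (σ x : ℝ) :
    HasDerivAt (gaussAvg σ k f) (gaussAvg σ k g x) x := by
  obtain ⟨hkm, c, hc0, hc⟩ := hk
  obtain ⟨C, hC0, hC⟩ := hg.exists_weight_bound
  refine (hasDerivAt_integral_of_dominated_loc_of_deriv_le (s := univ)
    (bound := fun z : ℝ × ℝ => c * C * (1 + z.1 ^ 2)⁻¹)
    (F' := fun x (z : ℝ × ℝ) => k z.1 * g z.1 (x - σ * z.2)) univ_mem
    (Eventually.of_forall fun y => (measurable_avg_integrand hkm hf σ y).aestronglyMeasurable)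
    (integrable_avg_integrand ⟨hkm, c, hc0, hc⟩ hf σ x)
    (measurable_avg_integrand hkm hg σ x).aestronglyMeasurable
    (ae_of_all _ fun z y _ => avg_integrand_bound hc0 hc hC _ _)
    (integrable_inv_one_add_sq_fst.const_mul (c * C))
    (ae_of_all _ fun z y _ => ?_)).2
  exact ((hd z.1 (y - σ * z.2)).comp_sub_const y (σ * z.2)).const_mul _

/-- Dominated convergence in both widths at once: the majorant is uniform in the position, so no
relation between the rates is needed. -/
lemma tendsto_gaussAvg {ι : Type*} {l : Filter ι} [l.IsCountablyGenerated] {σ : ι → ℝ}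
    {K : ι → ℝ → ℝ} (hσ : Tendsto σ l (𝓝 0)) (hK : ∀ i, Measurable (K i)) {c : ℝ} (hc0 : 0 ≤ c)
    (hc : ∀ᶠ i in l, ∀ q, |K i q| ≤ c * (1 + |q|))
    (hlim : ∀ q, Tendsto (fun i => K i q) l (𝓝 (k q)))
    (hf : RapidDecay f) (x : ℝ) :
    Tendsto (fun i => gaussAvg (σ i) (K i) f x) l (𝓝 (∫ q, k q * f q x)) := by
  obtain ⟨C, hC0, hC⟩ := hf.exists_weight_bound
  have e : ∫ q, k q * f q x = ∫ z : ℝ × ℝ, k z.1 * f z.1 x ∂(volume.prod stdGauss) := by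
    rw [integral_fun_fst (μ := volume) (ν := stdGauss) (fun q => k q * f q x)]
    simp
  rw [e]
  refine tendsto_integral_filter_of_dominated_convergence
    (fun z : ℝ × ℝ => c * C * (1 + z.1 ^ 2)⁻¹)
    (Eventually.of_forall fun i => (measurable_avg_integrand (hK i) hf _ x).aestronglyMeasurable)
    (hc.mono fun i hi => ae_of_all _ fun z => avg_integrand_bound hc0 hi hC _ _)
    (integrable_inv_one_add_sq_fst.const_mul (c * C)) (ae_of_all _ fun z => ?_)
  refine (hlim z.1).mul ?_
  have h1 : Tendsto (fun i => (z.1, x - σ i * z.2)) l (𝓝 (z.1, x)) := by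
    refine tendsto_const_nhds.prodMk_nhds ?_
    simpa using tendsto_const_nhds.sub (hσ.mul_const z.2) (a := x)
  exact (hf.cont.tendsto (z.1, x)).comp h1

lemma gaussAvg_add_const_mul {k' : ℝ → ℝ} (hk : LinearGrowth k) (hk' : LinearGrowth k')
    (hf : RapidDecay f) (c σ x : ℝ) :
    gaussAvg σ (fun q => k q + c * k' q) f x = gaussAvg σ k f x + c * gaussAvg σ k' f x := by
  unfold gaussAvg
  rw [← integral_const_mul, ← integral_add (integrable_avg_integrand hk hf σ x)
    ((integrable_avg_integrand hk' hf σ x).const_mul c)]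
  congr 1 with z
  ring

lemma gaussAvg_const_mul (c σ x : ℝ) :
    gaussAvg σ (fun q => c * k q) f x = c * gaussAvg σ k f x := by
  unfold gaussAvg
  rw [← integral_const_mul]
  simp only [mul_assoc]

end

lemma linearGrowth_const (c : ℝ) : LinearGrowth (fun _ => c) :=
  LinearGrowth.of_bounded measurable_const (c := |c|) (by simp)

lemma linearGrowth_gaussDensity {σ : ℝ} (hσ : 0 < σ) (p : ℝ) :
    LinearGrowth (fun q => gaussDensity σ (p - q)) :=
  LinearGrowth.of_bounded (by fun_prop) (c := (Real.sqrt (2 * Real.pi) * σ)⁻¹) fun q => by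
    rw [abs_of_nonneg (gaussDensity_nonneg hσ _)]; exact gaussDensity_le hσ _

/-! ### Cumulative momentum integrals and the Gaussian distribution function -/

/-- The probability that a Gaussian of width `σ` centred at `q` assigns to `(-∞, p]`. -/
def gaussCdf (σ p q : ℝ) : ℝ := ∫ r in Iic p, gaussDensity σ (r - q)

/-- The convolution with the Gaussian kernel can be integrated in momentum under the integral. -/
lemma setIntegral_smooth {σp σx : ℝ} (hp : 0 < σp) (hx : 0 < σx) {f : ℝ → ℝ → ℝ}
    (hf : RapidDecay f) (s : Set ℝ) (x : ℝ) :
    IntegrableOn (fun p => smooth σp σx f p x) s ∧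
    ∫ p in s, smooth σp σx f p x =
      gaussAvg σx (fun q => ∫ r in s, gaussDensity σp (r - q)) f x := by
  have hI : Integrable (Function.uncurry fun (p : ℝ) (z : ℝ × ℝ) =>
      gaussDensity σp (p - z.1) * f z.1 (x - σx * z.2))
      ((volume.restrict s).prod (volume.prod stdGauss)) := by
    have hfi := integrable_avg_integrand (linearGrowth_const 1) hf σx x
    have hI' : Integrable (Function.uncurry fun (p : ℝ) (z : ℝ × ℝ) =>
        gaussDensity σp (p - z.1) * f z.1 (x - σx * z.2))
        ((volume : Measure ℝ).prod (volume.prod stdGauss)) := by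
      have hm : Continuous (Function.uncurry fun (p : ℝ) (z : ℝ × ℝ) =>
          gaussDensity σp (p - z.1) * f z.1 (x - σx * z.2)) := by
        have h1 : Continuous fun w : ℝ × ℝ × ℝ =>
            Function.uncurry f (w.2.1, x - σx * w.2.2) := hf.cont.comp (by fun_prop)
        have h2 : Continuous fun w : ℝ × ℝ × ℝ => gaussDensity σp (w.1 - w.2.1) := by fun_prop
        exact h2.mul h1
      rw [integrable_prod_iff' hm.aestronglyMeasurable]
      -- Integrating first in p removes the Gaussian, which has mass one, and leaves the norm of the
      -- integrand of `gaussAvg` with kernel 1.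
      refine ⟨ae_of_all _ fun z => by
        simpa only [Function.uncurry_apply_pair] using
          ((integrable_gaussDensity hp).comp_sub_right z.1).mul_const (f z.1 (x - σx * z.2)), ?_⟩
      refine (hfi.norm).congr (ae_of_all _ fun z => ?_)
      simp only [Function.uncurry_apply_pair, norm_mul]
      rw [integral_mul_const, integral_sub_right_eq_self (fun r => ‖gaussDensity σp r‖)]
      simp only [Real.norm_eq_abs, abs_of_nonneg (gaussDensity_nonneg hp _)]
      rw [integral_gaussDensity hp]
      simp
    refine hI'.mono_measure ?_
    exact Measure.prod_mono Measure.restrict_le_self le_rfl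
  have e : (fun p => smooth σp σx f p x) = fun p => ∫ z : ℝ × ℝ,
      gaussDensity σp (p - z.1) * f z.1 (x - σx * z.2) ∂(volume.prod stdGauss) := by
    ext p
    rw [smooth_eq_gaussAvg hp hx hf, gaussAvg]
  rw [e]
  refine ⟨hI.integral_prod_left, ?_⟩
  rw [integral_integral_swap hI]
  unfold gaussAvg
  congr 1 with z
  rw [integral_mul_const]

/-- The reflection r ↦ 2q - r exchanges the two half-lines at q and preserves the density, so each
carries half of the mass. -/
lemma setIntegral_Iic_gaussDensity_self {σ : ℝ} (hσ : 0 < σ) (q : ℝ) :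
    ∫ r in Iic q, gaussDensity σ (r - q) = 1 / 2 := by
  have hI : Integrable (fun r => gaussDensity σ (r - q)) :=
    (integrable_gaussDensity hσ).comp_sub_right q
  have htot : ∫ r, gaussDensity σ (r - q) = 1 := by
    rw [integral_sub_right_eq_self (fun r => gaussDensity σ r), integral_gaussDensity hσ]
  have hsplit := integral_add_compl (measurableSet_Iic (a := q)) hI
  have href := (Measure.measurePreserving_sub_left (volume : Measure ℝ) (2 * q)).setIntegral_preimage_emb
    (MeasurableEquiv.subLeft (2 * q)).measurableEmbedding (fun r => gaussDensity σ (r - q)) (Ioi q)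
  have hpre : (fun r => 2 * q - r) ⁻¹' Ioi q = Iio q := by
    ext r; simp only [mem_preimage, mem_Ioi, mem_Iio]; constructor <;> intro h <;> linarith
  rw [hpre, ← integral_Iic_eq_integral_Iio] at href
  have hsym : ∀ r, gaussDensity σ (2 * q - r - q) = gaussDensity σ (r - q) := fun r => by
    rw [gaussDensity_sub_comm σ r q]; congr 1; ring
  simp_rw [hsym] at href
  rw [compl_Iic, ← href, htot] at hsplit
  linarith

lemma gaussCdf_eq {σ : ℝ} (hσ : 0 < σ) (p q : ℝ) :
    gaussCdf σ p q = 1 / 2 + ∫ r in (0 : ℝ)..(p - q), gaussDensity σ r := by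
  have hI : Integrable (fun r => gaussDensity σ (r - q)) :=
    (integrable_gaussDensity hσ).comp_sub_right q
  have h := intervalIntegral.integral_Iic_sub_Iic (hI.integrableOn (s := Iic q))
    (hI.integrableOn (s := Iic p))
  rw [intervalIntegral.integral_comp_sub_right (fun r => gaussDensity σ r), sub_self,
    setIntegral_Iic_gaussDensity_self hσ] at h
  unfold gaussCdf
  linarith

/-- The deviation of `gaussCdf` from `1 / 2`, multiplied by `√(2π) σ`. -/
def scaledErf (σ u : ℝ) : ℝ := ∫ r in (0 : ℝ)..u, Real.exp (-(r ^ 2 / (2 * σ ^ 2)))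

/-- Separates the two orders in `σ`: the constant 1/2, which will cancel in the gauge term, and a
part of order 1/σ, which survives relative to Q. -/
lemma gaussCdf_eq_scaledErf {σ : ℝ} (hσ : 0 < σ) (p q : ℝ) :
    gaussCdf σ p q = 1 / 2 + (Real.sqrt (2 * Real.pi) * σ)⁻¹ * scaledErf σ (p - q) := by
  rw [gaussCdf_eq hσ, scaledErf, ← intervalIntegral.integral_const_mul]
  rfl

lemma continuous_scaledErf (σ : ℝ) : Continuous (scaledErf σ) :=
  intervalIntegral.continuous_primitive (fun a b => Continuous.intervalIntegrable (by fun_prop) _ _) 0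

lemma abs_scaledErf_le (σ u : ℝ) : |scaledErf σ u| ≤ |u| := by
  have h := intervalIntegral.norm_integral_le_of_norm_le_const (a := 0) (b := u) (C := 1)
    (f := fun r => Real.exp (-(r ^ 2 / (2 * σ ^ 2)))) (fun r _ => by
      rw [Real.norm_eq_abs, abs_of_pos (Real.exp_pos _), Real.exp_le_one_iff]
      have : 0 ≤ r ^ 2 / (2 * σ ^ 2) := by positivity
      linarith)
  simpa [scaledErf] using h

lemma tendsto_exp_neg_sq_div (r : ℝ) :
    Tendsto (fun σ : ℝ => Real.exp (-(r ^ 2 / (2 * σ ^ 2)))) atTop (𝓝 1) := by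
  have h : Tendsto (fun σ : ℝ => 2 * σ ^ 2) atTop atTop :=
    (tendsto_pow_atTop two_ne_zero).const_mul_atTop two_pos
  have h2 : Tendsto (fun σ : ℝ => -(r ^ 2 / (2 * σ ^ 2))) atTop (𝓝 0) := by
    simpa using (h.const_div_atTop (r ^ 2)).neg
  simpa [Function.comp_def] using (Real.continuous_exp.tendsto 0).comp h2

lemma tendsto_scaledErf (u : ℝ) : Tendsto (fun σ : ℝ => scaledErf σ u) atTop (𝓝 u) := by
  have h := intervalIntegral.tendsto_integral_filter_of_dominated_convergence (μ := volume)
    (a := 0) (b := u) (l := atTop) (F := fun (σ r : ℝ) => Real.exp (-(r ^ 2 / (2 * σ ^ 2))))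
    (f := fun _ => (1 : ℝ)) (fun _ => (1 : ℝ))
    (Eventually.of_forall fun σ => (by fun_prop : Continuous fun r : ℝ =>
      Real.exp (-(r ^ 2 / (2 * σ ^ 2)))).aestronglyMeasurable)
    (Eventually.of_forall fun σ => ae_of_all _ fun r _ => by
      rw [Real.norm_eq_abs, abs_of_pos (Real.exp_pos _), Real.exp_le_one_iff]
      have : 0 ≤ r ^ 2 / (2 * σ ^ 2) := by positivity
      linarith)
    intervalIntegrable_const (ae_of_all _ fun r _ => tendsto_exp_neg_sq_div r)
  simpa [scaledErf] using h

lemma linearGrowth_scaledErf (σ p : ℝ) : LinearGrowth (fun q => scaledErf σ (p - q)) := by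
  refine ⟨((continuous_scaledErf σ).comp (by fun_prop)).measurable, 1 + |p|, by positivity,
    fun q => (abs_scaledErf_le _ _).trans ((abs_sub _ _).trans ?_)⟩
  have := abs_nonneg p
  have := abs_nonneg q
  nlinarith [mul_nonneg (abs_nonneg p) (abs_nonneg q)]

section
variable {σp σx : ℝ} {f g : ℝ → ℝ → ℝ}

lemma integral_smooth (hp : 0 < σp) (hx : 0 < σx) (hf : RapidDecay f) (x : ℝ) :
    ∫ p, smooth σp σx f p x = gaussAvg σx (fun _ => 1) f x := by
  have h := (setIntegral_smooth hp hx hf univ x).2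
  simp only [Measure.restrict_univ] at h
  rw [h]
  congr 1 with q
  rw [integral_sub_right_eq_self (fun r => gaussDensity σp r), integral_gaussDensity hp]

lemma integrable_smooth (hp : 0 < σp) (hx : 0 < σx) (hf : RapidDecay f) (x : ℝ) :
    Integrable (fun p => smooth σp σx f p x) :=
  integrableOn_univ.1 (setIntegral_smooth hp hx hf univ x).1

lemma setIntegral_Iic_smooth (hp : 0 < σp) (hx : 0 < σx) (hf : RapidDecay f) (p x : ℝ) :
    ∫ q in Iic p, smooth σp σx f q x = gaussAvg σx (gaussCdf σp p) f x :=
  (setIntegral_smooth hp hx hf (Iic p) x).2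

lemma linearGrowth_gaussCdf (hp : 0 < σp) (p : ℝ) : LinearGrowth (gaussCdf σp p) := by
  obtain ⟨hm, c, hc0, hc⟩ := linearGrowth_scaledErf σp p
  have e : gaussCdf σp p = fun q =>
      1 / 2 + (Real.sqrt (2 * Real.pi) * σp)⁻¹ * scaledErf σp (p - q) := by
    ext q; exact gaussCdf_eq_scaledErf hp p q
  rw [e]
  refine ⟨measurable_const.add (hm.const_mul _),
    1 / 2 + (Real.sqrt (2 * Real.pi) * σp)⁻¹ * c, by positivity, fun q => ?_⟩
  refine (abs_add_le _ _).trans ?_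
  rw [abs_mul, abs_of_pos (by positivity : (0 : ℝ) < (Real.sqrt (2 * Real.pi) * σp)⁻¹),
    abs_of_pos (by norm_num : (0 : ℝ) < 1 / 2), add_mul]
  have := abs_nonneg q
  refine add_le_add (by linarith) ?_
  rw [mul_assoc]
  exact mul_le_mul_of_nonneg_left (hc q) (by positivity)

lemma gaussAvg_gaussCdf (hp : 0 < σp) (hf : RapidDecay f) (p x : ℝ) :
    gaussAvg σx (gaussCdf σp p) f x = 1 / 2 * gaussAvg σx (fun _ => 1) f x +
      (Real.sqrt (2 * Real.pi) * σp)⁻¹ * gaussAvg σx (fun q => scaledErf σp (p - q)) f x := by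
  have e : gaussCdf σp p = fun q => 1 / 2 * 1 +
      (Real.sqrt (2 * Real.pi) * σp)⁻¹ * scaledErf σp (p - q) := by
    ext q; rw [mul_one]; exact gaussCdf_eq_scaledErf hp p q
  rw [e, gaussAvg_add_const_mul (by exact linearGrowth_const _) (linearGrowth_scaledErf σp p) hf,
    gaussAvg_const_mul]

lemma continuous_smooth_momentum (hp : 0 < σp) (hx : 0 < σx) (hf : RapidDecay f) (x : ℝ) :
    Continuous (fun p => smooth σp σx f p x) := by
  obtain ⟨C, hC0, hC⟩ := hf.exists_weight_bound
  have e : (fun p => smooth σp σx f p x) = fun p => ∫ z : ℝ × ℝ,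
      gaussDensity σp (p - z.1) * f z.1 (x - σx * z.2) ∂(volume.prod stdGauss) := by
    ext p
    rw [smooth_eq_gaussAvg hp hx hf, gaussAvg]
  rw [e]
  refine continuous_of_dominated
    (bound := fun z : ℝ × ℝ => (Real.sqrt (2 * Real.pi) * σp)⁻¹ * C * (1 + z.1 ^ 2)⁻¹)
    (fun p => (measurable_avg_integrand (linearGrowth_gaussDensity hp p).1 hf
      σx x).aestronglyMeasurable) (fun p => ae_of_all _ fun z => ?_)
    (integrable_inv_one_add_sq_fst.const_mul _) (ae_of_all _ fun z => by fun_prop)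
  refine avg_integrand_bound (k := fun q => gaussDensity σp (p - q)) (by positivity) (fun q => ?_)
    hC z.1 _
  rw [abs_of_nonneg (gaussDensity_nonneg hp _)]
  refine (gaussDensity_le hp _).trans (le_mul_of_one_le_right (by positivity) ?_)
  linarith [abs_nonneg q]

lemma hasDerivAt_setIntegral_Iic {u : ℝ → ℝ} (hu : Continuous u) (hI : Integrable u) (p : ℝ) :
    HasDerivAt (fun p => ∫ q in Iic p, u q) (u p) p := by
  have e : (fun p => ∫ q in Iic p, u q) = fun p => (∫ q in Iic 0, u q) + ∫ q in (0 : ℝ)..p, u q := by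
    ext p
    rw [← intervalIntegral.integral_Iic_sub_Iic hI.integrableOn hI.integrableOn]
    ring
  rw [e]
  exact (intervalIntegral.integral_hasDerivAt_right (hu.intervalIntegrable _ _)
    (hu.stronglyMeasurableAtFilter _ _) hu.continuousAt).const_add _

/-- The average against `gaussCdf` is the integral of the smoothed function over (-∞, p], so this is
the fundamental theorem of calculus. It serves both for ∂_p A and for the momentum derivative of ∂_x
A. -/
lemma hasDerivAt_gaussAvg_gaussCdf (hp : 0 < σp) (hx : 0 < σx) (hf : RapidDecay f) (p x : ℝ) :
    HasDerivAt (fun p => gaussAvg σx (gaussCdf σp p) f x) (smooth σp σx f p x) p := by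
  have h := hasDerivAt_setIntegral_Iic (continuous_smooth_momentum hp hx hf x)
    (integrable_smooth hp hx hf x) p
  simpa only [setIntegral_Iic_smooth hp hx hf] using h

lemma hasDerivAt_smooth_position (hp : 0 < σp) (hx : 0 < σx) (hf : RapidDecay f)
    (hg : RapidDecay g) (hd : ∀ p x, HasDerivAt (f p) (g p x) x) (p x : ℝ) :
    HasDerivAt (fun x => smooth σp σx f p x) (smooth σp σx g p x) x := by
  simp only [smooth_eq_gaussAvg hp hx hf, smooth_eq_gaussAvg hp hx hg]
  exact hasDerivAt_gaussAvg (linearGrowth_gaussDensity hp p) hf hg hd σx x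

end

/-! ### Gaussian averages in the singular limit -/

instance : bohmianLimit.IsCountablyGenerated := by unfold bohmianLimit; infer_instance

lemma bohmianLimit_pos : ∀ᶠ σ : ℝ × ℝ in bohmianLimit, 0 < σ.1 ∧ 0 < σ.2 :=
  (eventually_gt_atTop 0).prod_mk self_mem_nhdsWithin

lemma tendsto_fst_bohmianLimit : Tendsto Prod.fst bohmianLimit (atTop : Filter ℝ) := tendsto_fst

lemma tendsto_snd_bohmianLimit : Tendsto Prod.snd bohmianLimit (𝓝 (0 : ℝ)) :=
  tendsto_snd.mono_right nhdsWithin_le_nhds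

section
variable {f : ℝ → ℝ → ℝ}

lemma tendsto_gaussAvg_one (hf : RapidDecay f) (x : ℝ) :
    Tendsto (fun σ : ℝ × ℝ => gaussAvg σ.2 (fun _ => 1) f x) bohmianLimit (𝓝 (∫ q, f q x)) := by
  have h := tendsto_gaussAvg (K := fun _ _ => 1) (k := fun _ => 1) tendsto_snd_bohmianLimit
    (fun _ => measurable_const) zero_le_one (Eventually.of_forall fun _ q => by
      simp) (fun _ => tendsto_const_nhds) hf x
  simpa using h

/-- The factor √(2π) σp cancels the normalisation of the momentum Gaussian; what is left is at most
1 and tends pointwise to 1, so the dependence on p is lost. -/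
lemma tendsto_scaled_smooth (hf : RapidDecay f) (p x : ℝ) :
    Tendsto (fun σ : ℝ × ℝ => Real.sqrt (2 * Real.pi) * σ.1 * smooth σ.1 σ.2 f p x) bohmianLimit
      (𝓝 (∫ q, f q x)) := by
  have h := tendsto_gaussAvg (l := bohmianLimit) (σ := Prod.snd)
    (K := fun (σ : ℝ × ℝ) q => Real.exp (-((p - q) ^ 2 / (2 * σ.1 ^ 2)))) (k := fun _ => 1)
    tendsto_snd_bohmianLimit (fun _ => by fun_prop) zero_le_one
    (Eventually.of_forall fun σ q => by
      rw [abs_of_pos (Real.exp_pos _), one_mul]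
      have : Real.exp (-((p - q) ^ 2 / (2 * σ.1 ^ 2))) ≤ 1 := by
        rw [Real.exp_le_one_iff]
        have : 0 ≤ (p - q) ^ 2 / (2 * σ.1 ^ 2) := by positivity
        linarith
      linarith [abs_nonneg q])
    (fun q => (tendsto_exp_neg_sq_div (p - q)).comp tendsto_fst_bohmianLimit) hf x
  simp only [one_mul] at h
  refine h.congr' ?_
  filter_upwards [bohmianLimit_pos] with σ hσ
  rw [smooth_eq_gaussAvg hσ.1 hσ.2 hf, ← gaussAvg_const_mul]
  congr 1 with q
  have : Real.sqrt (2 * Real.pi) * σ.1 ≠ 0 := (mul_pos sqrt_two_pi_pos hσ.1).ne'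
  rw [gaussDensity, mul_inv_cancel_left₀ this]

lemma tendsto_gaussAvg_scaledErf (hf : RapidDecay f) (p x : ℝ) :
    Tendsto (fun σ : ℝ × ℝ => gaussAvg σ.2 (fun q => scaledErf σ.1 (p - q)) f x) bohmianLimit
      (𝓝 (∫ q, (p - q) * f q x)) := by
  refine tendsto_gaussAvg tendsto_snd_bohmianLimit
    (fun σ => (linearGrowth_scaledErf σ.1 p).1) (c := 1 + |p|) (by positivity)
    (Eventually.of_forall fun σ q => (abs_scaledErf_le _ _).trans ((abs_sub _ _).trans ?_))
    (fun q => (tendsto_scaledErf (p - q)).comp tendsto_fst_bohmianLimit) hf x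
  nlinarith [mul_nonneg (abs_nonneg p) (abs_nonneg q), abs_nonneg p, abs_nonneg q]

end

/-! ### Fourier transform in the relative position -/

lemma norm_exp_neg_I_mul (r : ℝ) : ‖Complex.exp (-Complex.I * (r : ℂ))‖ = 1 := by
  rw [show -Complex.I * (r : ℂ) = ((-r : ℝ) : ℂ) * Complex.I by push_cast; ring]
  exact Complex.norm_exp_ofReal_mul_I _

/-- Jointly continuous functions of `(x, y)` that are `O((1 + y²)⁻¹)` uniformly in `x`. -/
structure QuadDecay (F : ℝ → ℝ → ℂ) : Prop where
  cont : Continuous (Function.uncurry F)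
  bound : ∃ C : ℝ, ∀ x y, ‖F x y‖ ≤ C * (1 + y ^ 2)⁻¹

/-- The Fourier transform in the second variable, in the normalisation of the Wigner function. -/
def partialFourier (hbar : ℝ) (F : ℝ → ℝ → ℂ) (p x : ℝ) : ℂ :=
  ((1 / (2 * Real.pi * hbar) : ℝ) : ℂ) *
    ∫ y : ℝ, F x y * Complex.exp (-Complex.I * ((p * y / hbar : ℝ) : ℂ))

namespace QuadDecay

variable {F G : ℝ → ℝ → ℂ} {hbar : ℝ}

lemma add (hF : QuadDecay F) (hG : QuadDecay G) : QuadDecay (fun x y => F x y + G x y) where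
  cont := hF.cont.add hG.cont
  bound := by
    obtain ⟨C, hC⟩ := hF.bound
    obtain ⟨D, hD⟩ := hG.bound
    exact ⟨C + D, fun x y => (norm_add_le _ _).trans (by
      rw [add_mul]; exact add_le_add (hC x y) (hD x y))⟩

lemma const_mul (hF : QuadDecay F) (c : ℂ) : QuadDecay (fun x y => c * F x y) where
  cont := continuous_const.mul hF.cont
  bound := by
    obtain ⟨C, hC⟩ := hF.bound
    exact ⟨‖c‖ * C, fun x y => by
      rw [norm_mul, mul_assoc]; exact mul_le_mul_of_nonneg_left (hC x y) (norm_nonneg _)⟩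

lemma sub (hF : QuadDecay F) (hG : QuadDecay G) : QuadDecay (fun x y => F x y - G x y) := by
  simpa [sub_eq_add_neg] using hF.add (hG.const_mul (-1))

lemma continuous_right (hF : QuadDecay F) (x : ℝ) : Continuous (F x) := by
  have : Continuous fun y => Function.uncurry F (x, y) := hF.cont.comp (by fun_prop)
  exact this

lemma integrable (hF : QuadDecay F) (x : ℝ) : Integrable (F x) := by
  obtain ⟨C, hC⟩ := hF.bound
  exact (integrable_inv_one_add_sq.const_mul C).mono' (hF.continuous_right x).aestronglyMeasurable
    (ae_of_all _ fun y => hC x y)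

lemma integrable_mul_exp (hF : QuadDecay F) (p x : ℝ) :
    Integrable (fun y => F x y * Complex.exp (-Complex.I * ((p * y / hbar : ℝ) : ℂ))) := by
  refine (hF.integrable x).norm.mono' ?_ (ae_of_all _ fun y => ?_)
  · have := hF.continuous_right x
    exact (by fun_prop : Continuous fun y =>
      F x y * Complex.exp (-Complex.I * ((p * y / hbar : ℝ) : ℂ))).aestronglyMeasurable
  · rw [norm_mul, norm_exp_neg_I_mul, mul_one]

lemma continuous_partialFourier (hF : QuadDecay F) :
    Continuous (Function.uncurry (partialFourier hbar F)) := by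
  obtain ⟨C, hC⟩ := hF.bound
  refine continuous_const.mul (continuous_of_dominated (bound := fun y => C * (1 + y ^ 2)⁻¹)
    (fun z => (hF.integrable_mul_exp z.1 z.2).aestronglyMeasurable)
    (fun z => ae_of_all _ fun y => ?_) (integrable_inv_one_add_sq.const_mul C)
    (ae_of_all _ fun y => ?_))
  · rw [norm_mul, norm_exp_neg_I_mul, mul_one]
    exact hC _ _
  · have : Continuous fun z : ℝ × ℝ => Function.uncurry F (z.2, y) := hF.cont.comp (by fun_prop)
    exact this.mul (by fun_prop)

lemma norm_partialFourier_le (hF : QuadDecay F) :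
    ∃ C, ∀ p x, ‖partialFourier hbar F p x‖ ≤ C := by
  obtain ⟨C, hC⟩ := hF.bound
  refine ⟨|1 / (2 * Real.pi * hbar)| * ∫ y : ℝ, C * (1 + y ^ 2)⁻¹, fun p x => ?_⟩
  rw [partialFourier, norm_mul, Complex.norm_real, Real.norm_eq_abs]
  refine mul_le_mul_of_nonneg_left (norm_integral_le_of_norm_le
    (integrable_inv_one_add_sq.const_mul C) (ae_of_all _ fun y => ?_)) (abs_nonneg _)
  rw [norm_mul, norm_exp_neg_I_mul, mul_one]
  exact hC _ _

lemma partialFourier_add (hF : QuadDecay F) (hG : QuadDecay G) (p x : ℝ) :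
    partialFourier hbar (fun x y => F x y + G x y) p x =
      partialFourier hbar F p x + partialFourier hbar G p x := by
  simp only [partialFourier, add_mul]
  rw [integral_add (hF.integrable_mul_exp p x) (hG.integrable_mul_exp p x), mul_add]

lemma hasDerivAt_partialFourier (hF : QuadDecay F) (hG : QuadDecay G)
    (hd : ∀ x y, HasDerivAt (fun x => F x y) (G x y) x) (p x : ℝ) :
    HasDerivAt (partialFourier hbar F p) (partialFourier hbar G p x) x := by
  obtain ⟨C, hC⟩ := hG.bound
  refine HasDerivAt.const_mul _ (hasDerivAt_integral_of_dominated_loc_of_deriv_le (s := univ)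
    (bound := fun y => C * (1 + y ^ 2)⁻¹)
    (F' := fun x y => G x y * Complex.exp (-Complex.I * ((p * y / hbar : ℝ) : ℂ))) univ_mem
    (Eventually.of_forall fun z => (hF.integrable_mul_exp p z).aestronglyMeasurable)
    (hF.integrable_mul_exp p x) (hG.integrable_mul_exp p x).aestronglyMeasurable
    (ae_of_all _ fun y z _ => ?_) (integrable_inv_one_add_sq.const_mul C)
    (ae_of_all _ fun y z _ => (hd z y).mul_const _)).2
  rw [norm_mul, norm_exp_neg_I_mul, mul_one]
  exact hC _ _

/-- Multiplication by the momentum is `-iℏ` times the derivative in the relative position. -/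
lemma momentum_mul_partialFourier (hbar0 : hbar ≠ 0) (hF : QuadDecay F) (hG : QuadDecay G)
    (hd : ∀ x y, HasDerivAt (F x) (G x y) y) (p x : ℝ) :
    (p : ℂ) * partialFourier hbar F p x =
      -Complex.I * hbar * partialFourier hbar G p x := by
  have hc : (hbar : ℂ) ≠ 0 := by exact_mod_cast hbar0
  have he : ∀ y : ℝ, HasDerivAt
      (fun y : ℝ => Complex.exp (-Complex.I * ((p * y / hbar : ℝ) : ℂ)))
      (Complex.exp (-Complex.I * ((p * y / hbar : ℝ) : ℂ)) * (-Complex.I * (p / hbar : ℂ))) y := by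
    intro y
    have h1 : HasDerivAt (fun y : ℝ => ((p * y / hbar : ℝ) : ℂ)) (p / hbar : ℂ) y := by
      have := (((hasDerivAt_id y).const_mul p).div_const hbar).ofReal_comp
      simpa using this
    exact (h1.const_mul (-Complex.I)).cexp
  -- Integration by parts on the whole line; integrability of the product `F x y * exp` makes the
  -- boundary terms vanish.
  have h := integral_mul_deriv_eq_deriv_mul_of_integrable (u := F x) (u' := G x)
    (fun y _ => hd x y) (fun y _ => he y) ?_ (hG.integrable_mul_exp p x) (hF.integrable_mul_exp p x)
  · have h2 : ∫ y, F x y * (Complex.exp (-Complex.I * ((p * y / hbar : ℝ) : ℂ)) *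
        (-Complex.I * (p / hbar : ℂ))) = (-Complex.I * (p / hbar : ℂ)) *
        ∫ y, F x y * Complex.exp (-Complex.I * ((p * y / hbar : ℝ) : ℂ)) := by
      rw [← integral_const_mul]
      congr 1 with y
      ring
    rw [h2] at h
    unfold partialFourier
    set A := ∫ y, F x y * Complex.exp (-Complex.I * ((p * y / hbar : ℝ) : ℂ))
    set B := ∫ y, G x y * Complex.exp (-Complex.I * ((p * y / hbar : ℝ) : ℂ))
    have h3 : (p : ℂ) * A = -Complex.I * hbar * B := by
      have : B = Complex.I * (p / hbar : ℂ) * A := by linear_combination h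
      rw [this]
      field_simp
      linear_combination (p * A) * Complex.I_sq
    linear_combination (((1 / (2 * Real.pi * hbar) : ℝ) : ℂ)) * h3
  · refine ((hF.integrable_mul_exp (hbar := hbar) p x).mul_const
      (-Complex.I * (p / hbar : ℂ))).congr (ae_of_all _ fun y => ?_)
    simp only [Pi.mul_apply]
    ring

/-- Fourier inversion after the substitution p = 2πℏw. At y = 0 it yields the momentum marginals, at
general y it undoes the Wigner transform. -/
lemma integral_partialFourier_mul_exp (hb : 0 < hbar) (hF : QuadDecay F) (x : ℝ)
    (hI : Integrable (fun p => partialFourier hbar F p x)) (y : ℝ) :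
    ∫ p, partialFourier hbar F p x * Complex.exp (Complex.I * ((p * y / hbar : ℝ) : ℂ)) = F x y := by
  open FourierTransform in
  have hpos : 0 < 2 * Real.pi * hbar := by positivity
  have hne : ((2 * Real.pi * hbar : ℝ) : ℂ) ≠ 0 := by exact_mod_cast hpos.ne'
  have hFour : ∀ w : ℝ, 𝓕 (F x) w =
      ((2 * Real.pi * hbar : ℝ) : ℂ) * partialFourier hbar F ((2 * Real.pi * hbar) * w) x := by
    intro w
    rw [Real.fourier_real_eq_integral_exp_smul, partialFourier, ← mul_assoc, ← Complex.ofReal_mul,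
      mul_one_div_cancel hpos.ne', Complex.ofReal_one, one_mul]
    congr 1 with v
    rw [smul_eq_mul, mul_comm]
    congr 2
    rw [show 2 * Real.pi * hbar * w * v / hbar = 2 * Real.pi * v * w by field_simp]
    push_cast
    ring
  have hFI : Integrable (𝓕 (F x)) := by
    have := (hI.comp_mul_left' hpos.ne').const_mul ((2 * Real.pi * hbar : ℝ) : ℂ)
    exact this.congr (ae_of_all _ fun w => (hFour w).symm)
  have hinv := (hF.integrable x).fourierInv_fourier_eq hFI
    (hF.continuous_right x).continuousAt (v := y)
  rw [Real.fourierInv_eq'] at hinv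
  rw [← hinv]
  have hsub := Measure.integral_comp_mul_left (fun p : ℝ => partialFourier hbar F p x *
    Complex.exp (Complex.I * ((p * y / hbar : ℝ) : ℂ))) (2 * Real.pi * hbar)
  rw [abs_of_pos (inv_pos.2 hpos), eq_inv_smul_iff₀ hpos.ne'] at hsub
  rw [← hsub, ← integral_smul]
  congr 1 with w
  rw [hFour, smul_eq_mul, Complex.real_smul, mul_comm (Complex.exp _), ← mul_assoc]
  congr 2
  simp only [RCLike.inner_apply, conj_trivial]
  rw [show 2 * Real.pi * hbar * w * y / hbar = 2 * Real.pi * (y * w) by field_simp]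
  push_cast
  ring

end QuadDecay

/-! ### Off-diagonal densities and their Wigner transforms -/

section crossDensity

/-- The derivative of a Schwartz function. -/
abbrev sderiv (φ : SchwartzMap ℝ ℂ) : SchwartzMap ℝ ℂ := derivCLM ℂ ℂ φ

lemma hasDerivAt_sderiv (φ : SchwartzMap ℝ ℂ) (x : ℝ) : HasDerivAt φ (sderiv φ x) x := by
  rw [derivCLM_apply]; exact φ.hasDerivAt x

/-- The off-diagonal density `φ*(x - y/2) ψ(x + y/2)`. -/
def crossDensity (φ ψ : ℝ → ℂ) (x y : ℝ) : ℂ :=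
  starRingEnd ℂ (φ (x - y / 2)) * ψ (x + y / 2)

lemma continuous_crossDensity {φ ψ : ℝ → ℂ} (hφ : Continuous φ) (hψ : Continuous ψ) :
    Continuous (Function.uncurry (crossDensity φ ψ)) := by
  have : Continuous fun z : ℝ × ℝ =>
      starRingEnd ℂ (φ (z.1 - z.2 / 2)) * ψ (z.1 + z.2 / 2) :=
    (Complex.continuous_conj.comp (hφ.comp (by fun_prop))).mul (hψ.comp (by fun_prop))
  exact this

/-- The squares of x - y/2 and x + y/2 add up to 2x² + y²/2, so the product of the two weights is at
least (1 + y²)/2. This converts decay at both endpoints into decay in y uniform in x. -/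
lemma quad_weight_le (x y : ℝ) :
    (1 + (x - y / 2) ^ 2)⁻¹ * (1 + (x + y / 2) ^ 2)⁻¹ ≤ 2 * (1 + y ^ 2)⁻¹ := by
  rw [← mul_inv, ← div_eq_mul_inv, inv_le_comm₀ (by positivity) (by positivity), inv_div,
    div_le_iff₀ two_pos]
  nlinarith [sq_nonneg x, sq_nonneg ((x - y / 2) * (x + y / 2))]

lemma quadDecay_crossDensity_of_bound {φ ψ : ℝ → ℂ} (hφ : Continuous φ) (hψ : Continuous ψ)
    {C D : ℝ} (hC : ∀ x, ‖φ x‖ ≤ C * (1 + x ^ 2)⁻¹) (hD : ∀ x, ‖ψ x‖ ≤ D * (1 + x ^ 2)⁻¹) :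
    QuadDecay (crossDensity φ ψ) where
  cont := continuous_crossDensity hφ hψ
  bound := by
    have hC0 : 0 ≤ C := by simpa using (norm_nonneg _).trans (hC 0)
    have hD0 : 0 ≤ D := by simpa using (norm_nonneg _).trans (hD 0)
    refine ⟨C * D * 2, fun x y => ?_⟩
    rw [crossDensity, norm_mul, RCLike.norm_conj]
    calc ‖φ (x - y / 2)‖ * ‖ψ (x + y / 2)‖
        ≤ (C * (1 + (x - y / 2) ^ 2)⁻¹) * (D * (1 + (x + y / 2) ^ 2)⁻¹) := by
          gcongr
          · exact hC _
          · exact hD _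
      _ = C * D * ((1 + (x - y / 2) ^ 2)⁻¹ * (1 + (x + y / 2) ^ 2)⁻¹) := by ring
      _ ≤ C * D * (2 * (1 + y ^ 2)⁻¹) := by
          exact mul_le_mul_of_nonneg_left (quad_weight_le x y) (by positivity)
      _ = _ := by ring

lemma exists_quad_bound_of_weights {φ : ℝ → ℂ} {A B : ℝ} (hA : ∀ x, ‖φ x‖ ≤ A)
    (hB : ∀ x, |x| ^ 2 * ‖φ x‖ ≤ B) (x : ℝ) : ‖φ x‖ ≤ (A + B) * (1 + x ^ 2)⁻¹ := by
  rw [← div_eq_mul_inv, le_div_iff₀ (by positivity), ← sq_abs]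
  linarith [hA x, hB x]

lemma exists_quad_bound (φ : SchwartzMap ℝ ℂ) : ∃ C, ∀ x, ‖φ x‖ ≤ C * (1 + x ^ 2)⁻¹ := by
  obtain ⟨A, -, hA⟩ := φ.decay 0 0
  obtain ⟨B, -, hB⟩ := φ.decay 2 0
  simp only [pow_zero, one_mul, norm_iteratedFDeriv_zero, Real.norm_eq_abs] at hA hB
  exact ⟨A + B, exists_quad_bound_of_weights hA hB⟩

lemma quadDecay_crossDensity (φ ψ : SchwartzMap ℝ ℂ) : QuadDecay (crossDensity φ ψ) := by
  obtain ⟨C, hC⟩ := exists_quad_bound φ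
  obtain ⟨D, hD⟩ := exists_quad_bound ψ
  exact quadDecay_crossDensity_of_bound φ.continuous ψ.continuous hC hD

/-- The derivative of a cross density in the mean position. -/
def crossDx (φ ψ : SchwartzMap ℝ ℂ) (x y : ℝ) : ℂ :=
  crossDensity (sderiv φ) ψ x y + crossDensity φ (sderiv ψ) x y

/-- The derivative of a cross density in the relative position. -/
def crossDy (φ ψ : SchwartzMap ℝ ℂ) (x y : ℝ) : ℂ :=
  (1 / 2) * (crossDensity φ (sderiv ψ) x y - crossDensity (sderiv φ) ψ x y)

lemma quadDecay_crossDx (φ ψ : SchwartzMap ℝ ℂ) : QuadDecay (crossDx φ ψ) :=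
  (quadDecay_crossDensity _ _).add (quadDecay_crossDensity _ _)

lemma quadDecay_crossDy (φ ψ : SchwartzMap ℝ ℂ) : QuadDecay (crossDy φ ψ) :=
  ((quadDecay_crossDensity _ _).sub (quadDecay_crossDensity _ _)).const_mul _

lemma hasDerivAt_crossDensity_fst (φ ψ : SchwartzMap ℝ ℂ) (x y : ℝ) :
    HasDerivAt (fun x => crossDensity φ ψ x y) (crossDx φ ψ x y) x := by
  have h1 := ((hasDerivAt_sderiv φ (x - y / 2)).comp_sub_const x (y / 2)).star
  have h2 := (hasDerivAt_sderiv ψ (x + y / 2)).comp_add_const x (y / 2)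
  exact h1.mul h2

lemma hasDerivAt_crossDensity_snd (φ ψ : SchwartzMap ℝ ℂ) (x y : ℝ) :
    HasDerivAt (crossDensity φ ψ x) (crossDy φ ψ x y) y := by
  have hy1 : HasDerivAt (fun y : ℝ => x - y / 2) (-(1 / 2)) y := by
    simpa using ((hasDerivAt_id y).div_const 2).const_sub x
  have hy2 : HasDerivAt (fun y : ℝ => x + y / 2) (1 / 2) y := by
    simpa using ((hasDerivAt_id y).div_const 2).const_add x
  have h1 := ((hasDerivAt_sderiv φ (x - y / 2)).scomp y hy1).star
  have h2 := (hasDerivAt_sderiv ψ (x + y / 2)).scomp y hy2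
  refine (h1.mul h2).congr_deriv ?_
  simp only [crossDy, crossDensity, Function.comp, Complex.real_smul, star_mul',
    RCLike.star_def, Complex.conj_ofReal]
  push_cast
  ring

/-- The Wigner transform of a pair of wave functions. -/
def crossWigner (hbar : ℝ) (φ ψ : SchwartzMap ℝ ℂ) : ℝ → ℝ → ℂ :=
  partialFourier hbar (crossDensity φ ψ)

variable {hbar : ℝ}

lemma continuous_crossWigner (φ ψ : SchwartzMap ℝ ℂ) :
    Continuous (Function.uncurry (crossWigner hbar φ ψ)) :=
  (quadDecay_crossDensity φ ψ).continuous_partialFourier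

lemma partialFourier_crossDy (φ ψ : SchwartzMap ℝ ℂ) (p x : ℝ) :
    partialFourier hbar (crossDy φ ψ) p x =
      (1 / 2) * (crossWigner hbar φ (sderiv ψ) p x - crossWigner hbar (sderiv φ) ψ p x) := by
  simp only [crossWigner, partialFourier, ← mul_sub]
  rw [← integral_sub ((quadDecay_crossDensity _ _).integrable_mul_exp p x)
    ((quadDecay_crossDensity _ _).integrable_mul_exp p x), mul_left_comm (1 / 2 : ℂ),
    ← integral_const_mul (1 / 2 : ℂ)]
  congr 1
  congr 1 with y
  simp only [crossDy]
  ring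

/-- Transforms of Schwartz pairs are closed under multiplication by p. This is why pairs φ ≠ ψ are
considered: decay of every order follows by induction, and all moments reduce to marginals. -/
lemma momentum_mul_crossWigner (hb : hbar ≠ 0) (φ ψ : SchwartzMap ℝ ℂ) (p x : ℝ) :
    (p : ℂ) * crossWigner hbar φ ψ p x = -Complex.I * hbar / 2 *
      (crossWigner hbar φ (sderiv ψ) p x - crossWigner hbar (sderiv φ) ψ p x) := by
  rw [crossWigner, (quadDecay_crossDensity φ ψ).momentum_mul_partialFourier hb
    (quadDecay_crossDy φ ψ) (hasDerivAt_crossDensity_snd φ ψ), partialFourier_crossDy]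
  ring

lemma crossWigner_bound (hb : hbar ≠ 0) (j : ℕ) (φ ψ : SchwartzMap ℝ ℂ) :
    ∃ C, ∀ p x, |p| ^ j * ‖crossWigner hbar φ ψ p x‖ ≤ C := by
  induction j generalizing φ ψ with
  | zero =>
    obtain ⟨C, hC⟩ := (quadDecay_crossDensity φ ψ).norm_partialFourier_le (hbar := hbar)
    exact ⟨C, fun p x => by simpa [crossWigner] using hC p x⟩
  | succ j ih =>
    obtain ⟨C, hC⟩ := ih φ (sderiv ψ)
    obtain ⟨D, hD⟩ := ih (sderiv φ) ψ
    refine ⟨|hbar| / 2 * (C + D), fun p x => ?_⟩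
    have e : |p| * ‖crossWigner hbar φ ψ p x‖ = |hbar| / 2 *
        ‖crossWigner hbar φ (sderiv ψ) p x - crossWigner hbar (sderiv φ) ψ p x‖ := by
      have := congrArg norm (momentum_mul_crossWigner hb φ ψ p x)
      simpa [norm_mul] using this
    rw [pow_succ, mul_assoc, e]
    calc |p| ^ j * (|hbar| / 2 *
          ‖crossWigner hbar φ (sderiv ψ) p x - crossWigner hbar (sderiv φ) ψ p x‖)
        ≤ |p| ^ j * (|hbar| / 2 *
          (‖crossWigner hbar φ (sderiv ψ) p x‖ + ‖crossWigner hbar (sderiv φ) ψ p x‖)) := by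
          gcongr; exact norm_sub_le _ _
      _ = |hbar| / 2 * (|p| ^ j * ‖crossWigner hbar φ (sderiv ψ) p x‖ +
          |p| ^ j * ‖crossWigner hbar (sderiv φ) ψ p x‖) := by ring
      _ ≤ _ := by
          gcongr
          · exact hC p x
          · exact hD p x

lemma rapidDecay_re_crossWigner (hb : hbar ≠ 0) (φ ψ : SchwartzMap ℝ ℂ) :
    RapidDecay (fun p x => (crossWigner hbar φ ψ p x).re) where
  cont := Complex.continuous_re.comp (continuous_crossWigner φ ψ)
  bound j := by
    obtain ⟨C, hC⟩ := crossWigner_bound hb j φ ψ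
    exact ⟨C, fun p x => le_trans (by gcongr; exact Complex.abs_re_le_norm _) (hC p x)⟩

lemma integrable_crossWigner (hb : hbar ≠ 0) (φ ψ : SchwartzMap ℝ ℂ) (x : ℝ) :
    Integrable (fun p => crossWigner hbar φ ψ p x) := by
  obtain ⟨C, hC⟩ := crossWigner_bound hb 0 φ ψ
  obtain ⟨D, hD⟩ := crossWigner_bound hb 2 φ ψ
  refine (integrable_inv_one_add_sq.const_mul (C + D)).mono' ?_ (ae_of_all _ fun p => ?_)
  · have : Continuous fun p => Function.uncurry (crossWigner hbar φ ψ) (p, x) :=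
      (continuous_crossWigner φ ψ).comp (by fun_prop)
    exact this.aestronglyMeasurable
  · exact exists_quad_bound_of_weights (φ := fun p => crossWigner hbar φ ψ p x)
      (fun p => by simpa using hC p x) (fun p => hD p x) p

lemma integral_crossWigner_mul_exp (hb : 0 < hbar) (φ ψ : SchwartzMap ℝ ℂ) (x y : ℝ) :
    ∫ p, crossWigner hbar φ ψ p x * Complex.exp (Complex.I * ((p * y / hbar : ℝ) : ℂ)) =
      crossDensity φ ψ x y :=
  (quadDecay_crossDensity φ ψ).integral_partialFourier_mul_exp hb x
    (integrable_crossWigner hb.ne' φ ψ x) y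

lemma integral_crossWigner (hb : 0 < hbar) (φ ψ : SchwartzMap ℝ ℂ) (x : ℝ) :
    ∫ p, crossWigner hbar φ ψ p x = starRingEnd ℂ (φ x) * ψ x := by
  have h := integral_crossWigner_mul_exp hb φ ψ x 0
  simpa [crossDensity] using h

lemma wigner_eq_re (ψ : SchwartzMap ℝ ℂ) (p x : ℝ) :
    wigner hbar ψ p x = (crossWigner hbar ψ ψ p x).re := by
  rw [wigner, crossWigner, partialFourier, Complex.re_ofReal_mul]
  rfl

/-- Conjugation combined with y ↦ -y exchanges the two factors. For φ = ψ this is the reality of the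
Wigner function. -/
lemma conj_crossWigner (φ ψ : SchwartzMap ℝ ℂ) (p x : ℝ) :
    starRingEnd ℂ (crossWigner hbar φ ψ p x) = crossWigner hbar ψ φ p x := by
  rw [crossWigner, crossWigner, partialFourier, partialFourier, map_mul, Complex.conj_ofReal,
    ← integral_conj, ← integral_neg_eq_self]
  congr 2 with y
  simp only [crossDensity, map_mul, Complex.conj_conj, ← Complex.exp_conj, map_neg, Complex.conj_I,
    Complex.conj_ofReal]
  rw [show x - -y / 2 = x + y / 2 by ring, show x + -y / 2 = x - y / 2 by ring]
  push_cast
  ring_nf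

lemma wigner_eq (ψ : SchwartzMap ℝ ℂ) (p x : ℝ) :
    (wigner hbar ψ p x : ℂ) = crossWigner hbar ψ ψ p x := by
  rw [wigner_eq_re]
  exact (Complex.conj_eq_iff_re.1 (conj_crossWigner ψ ψ p x))

/-- The position derivative of the Wigner function. -/
def wignerDx (hbar : ℝ) (ψ : SchwartzMap ℝ ℂ) (p x : ℝ) : ℝ :=
  (crossWigner hbar (sderiv ψ) ψ p x).re + (crossWigner hbar ψ (sderiv ψ) p x).re

lemma rapidDecay_wigner (hb : hbar ≠ 0) (ψ : SchwartzMap ℝ ℂ) : RapidDecay (wigner hbar ψ) := by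
  have e : wigner hbar ψ = fun p x => (crossWigner hbar ψ ψ p x).re := by
    ext p x; exact wigner_eq_re ψ p x
  rw [e]; exact rapidDecay_re_crossWigner hb ψ ψ

lemma RapidDecay.add {f g : ℝ → ℝ → ℝ} (hf : RapidDecay f) (hg : RapidDecay g) :
    RapidDecay (fun p x => f p x + g p x) where
  cont := hf.cont.add hg.cont
  bound j := by
    obtain ⟨C, hC⟩ := hf.bound j
    obtain ⟨D, hD⟩ := hg.bound j
    refine ⟨C + D, fun p x => le_trans ?_ (add_le_add (hC p x) (hD p x))⟩
    rw [← mul_add]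
    exact mul_le_mul_of_nonneg_left (abs_add_le _ _) (by positivity)

lemma rapidDecay_wignerDx (hb : hbar ≠ 0) (ψ : SchwartzMap ℝ ℂ) : RapidDecay (wignerDx hbar ψ) :=
  (rapidDecay_re_crossWigner hb _ _).add (rapidDecay_re_crossWigner hb _ _)

lemma hasDerivAt_wigner (ψ : SchwartzMap ℝ ℂ) (p x : ℝ) :
    HasDerivAt (wigner hbar ψ p) (wignerDx hbar ψ p x) x := by
  have e : wigner hbar ψ p = fun x => (crossWigner hbar ψ ψ p x).re := by
    ext x; exact wigner_eq_re ψ p x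
  have h := (quadDecay_crossDensity ψ ψ).hasDerivAt_partialFourier (hbar := hbar)
    (quadDecay_crossDx ψ ψ) (hasDerivAt_crossDensity_fst ψ ψ) p x
  have h2 := Complex.reCLM.hasFDerivAt.comp_hasDerivAt x h
  rw [e]
  refine h2.congr_deriv ?_
  simp only [Complex.reCLM_apply]
  unfold crossDx
  rw [(quadDecay_crossDensity _ _).partialFourier_add (quadDecay_crossDensity _ _)]
  rfl

end crossDensity

/-! ### Fourier inversion in the mean position -/

section inversion

lemma quadDecay_schwartz (g : SchwartzMap ℝ ℂ) : QuadDecay (fun _ y => g y) where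
  cont := g.continuous.comp continuous_snd
  bound := by
    obtain ⟨C, hC⟩ := exists_quad_bound g
    exact ⟨C, fun _ y => hC y⟩

lemma integrable_partialFourier_schwartz (g : SchwartzMap ℝ ℂ) (x : ℝ) :
    Integrable (fun p => partialFourier 1 (fun _ y => g y) p x) := by
  have hmul : ∀ (g : SchwartzMap ℝ ℂ) (p : ℝ), |p| * ‖partialFourier 1 (fun _ y => g y) p x‖ =
      ‖partialFourier 1 (fun _ y => sderiv g y) p x‖ := fun g p => by
    have := congrArg norm ((quadDecay_schwartz g).momentum_mul_partialFourier one_ne_zero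
      (quadDecay_schwartz (sderiv g)) (fun _ y => hasDerivAt_sderiv g y) p x)
    simpa using this
  obtain ⟨C, hC⟩ := (quadDecay_schwartz g).norm_partialFourier_le (hbar := 1)
  obtain ⟨D, hD⟩ := (quadDecay_schwartz (sderiv (sderiv g))).norm_partialFourier_le (hbar := 1)
  refine (integrable_inv_one_add_sq.const_mul (C + D)).mono' ?_ (ae_of_all _ fun p => ?_)
  · have : Continuous fun p => Function.uncurry (partialFourier 1 (fun _ y => g y)) (p, x) :=
      (quadDecay_schwartz g).continuous_partialFourier.comp (by fun_prop)
    exact this.aestronglyMeasurable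
  · refine exists_quad_bound_of_weights (φ := fun p => partialFourier 1 (fun _ y => g y) p x)
      (fun p => hC p x) (fun p => ?_) p
    -- Each factor of p becomes one derivative of `g`.
    rw [pow_two, mul_assoc, hmul, hmul]
    exact hD p x

/-- Fourier inversion in the angular-frequency normalisation. -/
lemma fourier_inversion_schwartz (g : SchwartzMap ℝ ℂ) (x : ℝ) :
    ∫ η : ℝ, (∫ y : ℝ, g y * Complex.exp (-Complex.I * ((η * y : ℝ) : ℂ))) *
      Complex.exp (Complex.I * ((η * x : ℝ) : ℂ)) = (2 * Real.pi : ℝ) * g x := by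
  have h := (quadDecay_schwartz g).integral_partialFourier_mul_exp one_pos 0
    (integrable_partialFourier_schwartz g 0) x
  rw [← h, ← integral_const_mul]
  congr 1 with η
  simp only [partialFourier, div_one, mul_one]
  rw [← mul_assoc, ← mul_assoc, ← Complex.ofReal_mul, mul_one_div_cancel (by positivity),
    Complex.ofReal_one, one_mul]

/-- A cross density as a Schwartz function of the mean position. -/
def crossDensitySlice (φ ψ : SchwartzMap ℝ ℂ) (y : ℝ) : SchwartzMap ℝ ℂ :=
  pairing (ContinuousLinearMap.mul ℝ ℂ)
    (postcompCLM (𝕜 := ℝ) Complex.conjCLE.toContinuousLinearMap (φ.compSubConstCLM ℝ (y / 2)))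
    (ψ.compSubConstCLM ℝ (-(y / 2)))

lemma crossDensitySlice_apply (φ ψ : SchwartzMap ℝ ℂ) (x y : ℝ) :
    crossDensitySlice φ ψ y x = crossDensity φ ψ x y := by
  simp [crossDensitySlice, crossDensity]

end inversion

/-! ### The sinc product with a Wigner function -/

section sincProduct

variable {hbar : ℝ}

/-- The momentum integral undoes the Wigner transform at y = -ℏξ. Only a Fourier transform in the
mean position is left, which the η integral of the sinc product inverts. -/
lemma phaseFourier_wigner (hb : 0 < hbar) (ψ : SchwartzMap ℝ ℂ) (ξ η : ℝ) :
    phaseFourier (wigner hbar ψ) ξ η = ∫ x : ℝ, crossDensitySlice ψ ψ (-hbar * ξ) x *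
      Complex.exp (-Complex.I * ((η * x : ℝ) : ℂ)) := by
  unfold phaseFourier
  congr 1 with x
  rw [crossDensitySlice_apply, ← integral_crossWigner_mul_exp hb, ← integral_mul_const]
  congr 1 with p
  rw [wigner_eq, mul_assoc, ← Complex.exp_add]
  congr 2
  rw [show p * (-hbar * ξ) / hbar = -(p * ξ) by field_simp]
  push_cast
  ring

/-- The sinc product with a Wigner function when the averaged right factor does not depend on the
frequency of position. -/
lemma sincProduct_wigner (hb : 0 < hbar) (ψ : SchwartzMap ℝ ℂ) (b : ℝ → ℝ → ℝ) (w : ℝ → ℝ)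
    (p x : ℝ) (hw : ∀ ξ η : ℝ, (1 / 2) * ∫ s in (-1 : ℝ)..1,
      b (p - s * hbar * η / 2) (x + s * hbar * ξ / 2) = w (-hbar * ξ)) :
    sincProduct hbar (wigner hbar ψ) b p x =
      (partialFourier hbar (fun x y => crossDensity ψ ψ x y * w y) p x).re := by
  have inner : ∀ ξ : ℝ, ∫ η : ℝ, phaseFourier (wigner hbar ψ) ξ η *
      Complex.exp (Complex.I * ((ξ * p + η * x : ℝ) : ℂ)) * (w (-hbar * ξ) : ℂ) =
      (2 * Real.pi : ℝ) * (crossDensity ψ ψ x (-hbar * ξ) * (w (-hbar * ξ) : ℂ) *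
        Complex.exp (-Complex.I * ((p * (-hbar * ξ) / hbar : ℝ) : ℂ))) := by
    intro ξ
    have h := fourier_inversion_schwartz (crossDensitySlice ψ ψ (-hbar * ξ)) x
    rw [crossDensitySlice_apply] at h
    rw [show (2 * Real.pi : ℝ) * (crossDensity ψ ψ x (-hbar * ξ) * (w (-hbar * ξ) : ℂ) *
        Complex.exp (-Complex.I * ((p * (-hbar * ξ) / hbar : ℝ) : ℂ))) =
        (2 * Real.pi : ℝ) * crossDensity ψ ψ x (-hbar * ξ) * ((w (-hbar * ξ) : ℂ) *
        Complex.exp (-Complex.I * ((p * (-hbar * ξ) / hbar : ℝ) : ℂ))) by ring, ← h,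
      ← integral_mul_const]
    congr 1 with η
    rw [phaseFourier_wigner hb]
    have e : Complex.exp (Complex.I * ((ξ * p + η * x : ℝ) : ℂ)) =
        Complex.exp (Complex.I * ((η * x : ℝ) : ℂ)) *
          Complex.exp (-Complex.I * ((p * (-hbar * ξ) / hbar : ℝ) : ℂ)) := by
      rw [← Complex.exp_add]
      congr 1
      rw [show p * (-hbar * ξ) / hbar = -(p * ξ) by field_simp]
      push_cast
      ring
    rw [e]
    ring
  unfold sincProduct
  simp_rw [hw, inner]
  -- Substitution y = -ℏξ: the Jacobian 1/ℏ and the constants 2π/(2π)² combine to the prefactor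
  -- 1/(2πℏ) of `partialFourier`.
  rw [integral_const_mul, Measure.integral_comp_mul_left (fun y => crossDensity ψ ψ x y *
    (w y : ℂ) * Complex.exp (-Complex.I * ((p * y / hbar : ℝ) : ℂ))) (-hbar), partialFourier,
    Complex.re_ofReal_mul, Complex.re_ofReal_mul, Complex.real_smul, Complex.re_ofReal_mul,
    inv_neg, abs_neg, abs_of_pos (inv_pos.2 hb)]
  field_simp

end sincProduct

/-! ### The Wigner flow and the mean force -/

section flow

variable {hbar m : ℝ} {V : ℝ → ℝ}

lemma wignerFlowX_eq (hb : 0 < hbar) (hm : 0 < m) (ψ : SchwartzMap ℝ ℂ) (p x : ℝ) :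
    wignerFlowX hbar m V ψ p x = 1 / m * (p * wigner hbar ψ p x) := by
  have hd : ∀ p' x', deriv (fun z => weylHamiltonian m V z x') p' = p' / m := by
    intro p' x'
    have : HasDerivAt (fun z => weylHamiltonian m V z x') (p' / m) p' := by
      unfold weylHamiltonian
      refine ((((hasDerivAt_id p').pow 2).div_const (2 * m)).add_const (V x')).congr_deriv ?_
      simp only [id]
      field_simp
      norm_num
    exact this.deriv
  unfold wignerFlowX
  simp_rw [hd]
  rw [sincProduct_wigner hb ψ _ (fun _ => p / m) p x (fun ξ η => ?_), wigner_eq_re]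
  · simp only [crossWigner, partialFourier, mul_right_comm _ ((p / m : ℝ) : ℂ), integral_mul_const]
    rw [← mul_assoc, Complex.re_mul_ofReal]
    ring
  -- The shift is odd in s, so it averages to zero over [-1, 1].
  · have e : ∀ s : ℝ, (p - s * hbar * η / 2) / m = p / m - s * (hbar * η / 2 / m) := by
      intro s; ring
    simp_rw [e]
    rw [intervalIntegral.integral_sub (by simp) (by
      exact (Continuous.intervalIntegrable (by fun_prop) _ _)),
      intervalIntegral.integral_mul_const, integral_id]
    simp
    ring

/-- The symmetric mean of `V'` over the segment between `x - y / 2` and `x + y / 2`. -/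
def forceMean (V : ℝ → ℝ) (x y : ℝ) : ℝ :=
  (1 / 2) * ∫ s in (-1 : ℝ)..1, deriv V (x + s * (y / 2))

lemma wignerFlowP_eq (hb : 0 < hbar) (ψ : SchwartzMap ℝ ℂ) (p x : ℝ) :
    wignerFlowP hbar m V ψ p x =
      -(partialFourier hbar (fun x y => crossDensity ψ ψ x y * (forceMean V x y : ℂ)) p x).re := by
  have hd : ∀ p' x', deriv (fun z => weylHamiltonian m V p' z) x' = deriv V x' := by
    intro p' x'
    unfold weylHamiltonian
    rw [deriv_const_add]
  unfold wignerFlowP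
  simp_rw [hd]
  rw [sincProduct_wigner hb ψ _ (fun y => forceMean V x y) p x (fun ξ η => ?_)]
  · simp only [partialFourier]
  · unfold forceMean
    congr 1
    -- At y = -ℏξ the segment is traversed backwards; the symmetric mean does not see this.
    have h := intervalIntegral.integral_comp_neg (a := -1) (b := 1)
      (fun s => deriv V (x + s * hbar * ξ / 2))
    rw [neg_neg] at h
    rw [← h]
    congr 1 with s
    congr 1
    ring

lemma continuous_forceMean (hV : ContDiff ℝ 1 V) :
    Continuous (Function.uncurry (forceMean V)) := by
  have hc : Continuous (deriv V) := hV.continuous_deriv le_rfl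
  refine continuous_const.mul
    (intervalIntegral.continuous_parametric_intervalIntegral_of_continuous' ?_ (-1) 1)
  exact hc.comp (by fun_prop)

lemma forceMean_zero (x : ℝ) : forceMean V x 0 = deriv V x := by
  simp [forceMean]; ring

/-- Fundamental theorem of calculus along the segment. It identifies the momentum divergence of the
flow with the commutator of the potential and ψ ψ*. -/
lemma mul_forceMean (hV : ContDiff ℝ 1 V) (x y : ℝ) :
    y * forceMean V x y = V (x + y / 2) - V (x - y / 2) := by
  have hc : Continuous (deriv V) := hV.continuous_deriv le_rfl
  have hd : ∀ s : ℝ, HasDerivAt (fun s => V (x + s * (y / 2)))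
      (deriv V (x + s * (y / 2)) * (y / 2)) s := by
    intro s
    have h1 : HasDerivAt (fun s => x + s * (y / 2)) (y / 2) s := by
      simpa using ((hasDerivAt_id s).mul_const (y / 2)).const_add x
    exact ((hV.differentiable one_ne_zero _).hasDerivAt).comp s h1
  have h := intervalIntegral.integral_eq_sub_of_hasDerivAt (a := -1) (b := 1)
    (fun s _ => hd s) (Continuous.intervalIntegrable (by fun_prop) _ _)
  rw [intervalIntegral.integral_mul_const] at h
  rw [forceMean]
  have e1 : x + 1 * (y / 2) = x + y / 2 := by ring
  have e2 : x + -1 * (y / 2) = x - y / 2 := by ring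
  rw [e1, e2] at h
  linarith

/-- Every point of the segment is a convex combination of the endpoints, so the growth of V' is
controlled by a product of one weight per endpoint. Each weight is then absorbed by the wave
function at that endpoint. -/
lemma abs_forceMean_le {C : ℝ} {k : ℕ} (hC0 : 0 ≤ C)
    (hC : ∀ x, |deriv V x| ≤ C * (1 + |x|) ^ k) (x y : ℝ) :
    |forceMean V x y| ≤ C * ((1 + |x - y / 2|) ^ k * (1 + |x + y / 2|) ^ k) := by
  have hb : ∀ s ∈ uIoc (-1 : ℝ) 1, ‖deriv V (x + s * (y / 2))‖ ≤
      C * ((1 + |x - y / 2|) ^ k * (1 + |x + y / 2|) ^ k) := by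
    intro s hs
    rw [uIoc_of_le (by norm_num)] at hs
    refine (hC _).trans (mul_le_mul_of_nonneg_left ?_ hC0)
    rw [← mul_pow]
    refine pow_le_pow_left₀ (by positivity) ?_ k
    have h1 : |x + s * (y / 2)| ≤ |x - y / 2| + |x + y / 2| := by
      rw [show x + s * (y / 2) = (1 - s) / 2 * (x - y / 2) + (1 + s) / 2 * (x + y / 2) by ring]
      refine (abs_add_le _ _).trans (add_le_add ?_ ?_)
      · rw [abs_mul, abs_of_nonneg (by linarith [hs.2])]
        exact mul_le_of_le_one_left (abs_nonneg _) (by linarith [hs.1])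
      · rw [abs_mul, abs_of_nonneg (by linarith [hs.1])]
        exact mul_le_of_le_one_left (abs_nonneg _) (by linarith [hs.2])
    nlinarith [mul_nonneg (abs_nonneg (x - y / 2)) (abs_nonneg (x + y / 2))]
  have h := intervalIntegral.norm_integral_le_of_norm_le_const hb
  rw [forceMean, abs_mul]
  rw [Real.norm_eq_abs] at h
  norm_num at h ⊢
  linarith

lemma exists_polynomial_weight_bound (k : ℕ) (ψ : SchwartzMap ℝ ℂ) :
    ∃ D, ∀ x : ℝ, (1 + |x|) ^ k * ‖ψ x‖ ≤ D * (1 + x ^ 2)⁻¹ := by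
  -- The bound for weight k + 2: the two extra powers dominate 1 + x².
  refine ⟨2 ^ (k + 2) * (Finset.Iic (k + 2, 0)).sup (fun m => SchwartzMap.seminorm ℝ m.1 m.2) ψ,
    fun x => ?_⟩
  have h := one_add_le_sup_seminorm_apply (𝕜 := ℝ) (m := (k + 2, 0)) (k := k + 2) (n := 0)
    le_rfl le_rfl ψ x
  rw [norm_iteratedFDeriv_zero, Real.norm_eq_abs] at h
  rw [← div_eq_mul_inv, le_div_iff₀ (by positivity)]
  refine le_trans ?_ h
  rw [pow_add, mul_right_comm]
  refine mul_le_mul_of_nonneg_right (mul_le_mul_of_nonneg_left ?_ (by positivity)) (norm_nonneg _)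
  rw [← sq_abs]
  nlinarith [abs_nonneg x]

lemma quadDecay_crossDensity_mul_forceMean (hV : ContDiff ℝ 1 V)
    (hVg : ∃ (C : ℝ) (k : ℕ), ∀ x : ℝ, |deriv V x| ≤ C * (1 + |x|) ^ k) (φ ψ : SchwartzMap ℝ ℂ) :
    QuadDecay (fun x y => crossDensity φ ψ x y * (forceMean V x y : ℂ)) where
  cont := (continuous_crossDensity φ.continuous ψ.continuous).mul
    (Complex.continuous_ofReal.comp (continuous_forceMean hV))
  bound := by
    obtain ⟨C, k, hC⟩ := hVg
    have hC0 : 0 ≤ C := by simpa using (abs_nonneg _).trans (hC 0)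
    have hw : ∀ χ : SchwartzMap ℝ ℂ, Continuous fun x : ℝ => (((1 + |x|) ^ k : ℝ) : ℂ) * χ x :=
      fun χ => by fun_prop
    have hn : ∀ (χ : SchwartzMap ℝ ℂ) (x : ℝ),
        ‖(((1 + |x|) ^ k : ℝ) : ℂ) * χ x‖ = (1 + |x|) ^ k * ‖χ x‖ := fun χ x => by
      rw [norm_mul, Complex.norm_real, Real.norm_eq_abs, abs_of_nonneg (by positivity)]
    obtain ⟨D, hD⟩ := exists_polynomial_weight_bound k φ
    obtain ⟨E, hE⟩ := exists_polynomial_weight_bound k ψ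
    obtain ⟨B, hB⟩ := (quadDecay_crossDensity_of_bound (hw φ) (hw ψ)
      (fun x => (hn φ x).le.trans (hD x)) (fun x => (hn ψ x).le.trans (hE x))).bound
    refine ⟨C * B, fun x y => ?_⟩
    have h1 := hB x y
    have h2 := abs_forceMean_le hC0 hC x y
    rw [crossDensity, norm_mul, RCLike.norm_conj, hn, hn] at h1
    rw [crossDensity, norm_mul, norm_mul, RCLike.norm_conj, Complex.norm_real, Real.norm_eq_abs]
    calc ‖φ (x - y / 2)‖ * ‖ψ (x + y / 2)‖ * |forceMean V x y|
        ≤ ‖φ (x - y / 2)‖ * ‖ψ (x + y / 2)‖ *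
          (C * ((1 + |x - y / 2|) ^ k * (1 + |x + y / 2|) ^ k)) := by gcongr
      _ = C * ((1 + |x - y / 2|) ^ k * ‖φ (x - y / 2)‖ *
          ((1 + |x + y / 2|) ^ k * ‖ψ (x + y / 2)‖)) := by ring
      _ ≤ C * (B * (1 + y ^ 2)⁻¹) := mul_le_mul_of_nonneg_left h1 hC0
      _ = _ := by ring

end flow

/-! ### Phase-space smoothing in the relative position -/

section relativePosition

variable {hbar : ℝ} {F : ℝ → ℝ → ℂ}

/-- The average of `F(x - σ z₂, τ z₁) exp(-i p z₁)` over two independent standard Gaussians. -/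
def gaussSampling (F : ℝ → ℝ → ℂ) (σ τ p x : ℝ) : ℂ :=
  ∫ z : ℝ × ℝ, F (x - σ * z.2) (τ * z.1) * Complex.exp (-Complex.I * ((p * z.1 : ℝ) : ℂ))
    ∂(stdGauss.prod stdGauss)

lemma integral_gaussDensity_mul_exp {σ : ℝ} (hσ : 0 < σ) (hb : 0 < hbar) (p y : ℝ) :
    ∫ q : ℝ, (gaussDensity σ (p - q) : ℂ) * Complex.exp (-Complex.I * ((q * y / hbar : ℝ) : ℂ)) =
      ((Real.sqrt (2 * Real.pi) * (hbar / σ) * gaussDensity (hbar / σ) y : ℝ) : ℂ) *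
        Complex.exp (-Complex.I * ((p * y / hbar : ℝ) : ℂ)) := by
  have hτ : Real.sqrt (2 * Real.pi) * (hbar / σ) ≠ 0 :=
    (mul_pos sqrt_two_pi_pos (div_pos hb hσ)).ne'
  rw [gaussDensity, mul_inv_cancel_left₀ hτ]
  rw [← integral_sub_left_eq_self _ volume p]
  have e : ∀ u : ℝ, (gaussDensity σ (p - (p - u)) : ℂ) *
      Complex.exp (-Complex.I * (((p - u) * y / hbar : ℝ) : ℂ)) =
      Complex.exp (-Complex.I * ((p * y / hbar : ℝ) : ℂ)) *
        (gaussDensity σ u • Complex.exp (((y / hbar : ℝ) : ℂ) * u * Complex.I)) := by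
    intro u
    rw [sub_sub_cancel, Complex.real_smul, mul_left_comm, ← Complex.exp_add]
    congr 2
    push_cast
    ring
  simp_rw [e]
  rw [integral_const_mul, integral_gaussDensity_smul hσ, mul_comm]
  congr 1
  have h := charFun_gaussianReal (μ := 0) (v := 1) (y / hbar * σ)
  rw [charFun_apply_real] at h
  rw [Complex.ofReal_exp]
  have e2 : Complex.exp (((y / hbar * σ : ℝ) : ℂ) * ((0 : ℝ) : ℂ) * Complex.I -
      ((1 : NNReal) : ℂ) * ((y / hbar * σ : ℝ) : ℂ) ^ 2 / 2) =
      Complex.exp ((-(y ^ 2 / (2 * (hbar / σ) ^ 2)) : ℝ) : ℂ) := by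
    congr 1
    push_cast
    have : (hbar : ℂ) ≠ 0 := by exact_mod_cast hb.ne'
    have : (σ : ℂ) ≠ 0 := by exact_mod_cast hσ.ne'
    field_simp
    simp
    ring
  rw [← e2, ← h]
  congr 1 with z
  congr 1
  push_cast
  ring

lemma QuadDecay.integrable_sampling (hF : QuadDecay F) (σ τ p x : ℝ) :
    Integrable (fun z : ℝ × ℝ => F (x - σ * z.2) (τ * z.1) *
      Complex.exp (-Complex.I * ((p * z.1 : ℝ) : ℂ))) (stdGauss.prod stdGauss) := by
  obtain ⟨C, hC⟩ := hF.bound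
  have hC0 : 0 ≤ C := by simpa using (norm_nonneg _).trans (hC 0 0)
  have h1 : Continuous fun z : ℝ × ℝ => Function.uncurry F (x - σ * z.2, τ * z.1) :=
    hF.cont.comp (by fun_prop)
  refine (integrable_const C).mono' (h1.mul (by fun_prop)).aestronglyMeasurable
    (ae_of_all _ fun z => ?_)
  rw [norm_mul, norm_exp_neg_I_mul, mul_one]
  refine (hC _ _).trans (mul_le_of_le_one_right hC0 (inv_le_one_of_one_le₀ ?_))
  nlinarith [sq_nonneg (τ * z.1)]

lemma integral_gaussDensity_mul_partialFourier {σ : ℝ} (hσ : 0 < σ) (hb : 0 < hbar)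
    (hF : QuadDecay F) (p x : ℝ) :
    ∫ q, (partialFourier hbar F q x).re * gaussDensity σ (p - q) =
      (Real.sqrt (2 * Real.pi) * σ)⁻¹ * (∫ z, F x (hbar / σ * z) *
        Complex.exp (-Complex.I * ((p / σ * z : ℝ) : ℂ)) ∂stdGauss).re := by
  have hτ : 0 < hbar / σ := div_pos hb hσ
  have hgI : Integrable (fun q => (gaussDensity σ (p - q) : ℂ)) :=
    ((integrable_gaussDensity hσ).comp_sub_left p).ofReal
  obtain ⟨B, hB⟩ := hF.norm_partialFourier_le (hbar := hbar)
  have hcont : Continuous fun q => Function.uncurry (partialFourier hbar F) (q, x) :=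
    hF.continuous_partialFourier.comp (by fun_prop)
  have hI : Integrable (fun q => (gaussDensity σ (p - q) : ℂ) * partialFourier hbar F q x) :=
    hgI.mul_bdd hcont.aestronglyMeasurable (ae_of_all _ fun q => hB q x)
  have e1 : ∫ q, (partialFourier hbar F q x).re * gaussDensity σ (p - q) =
      (∫ q, (gaussDensity σ (p - q) : ℂ) * partialFourier hbar F q x).re := by
    have := integral_re hI
    simp only [RCLike.re_to_complex] at this
    rw [← this]
    congr 1 with q
    rw [Complex.re_ofReal_mul, mul_comm]
  have hprod : Integrable (Function.uncurry fun (q y : ℝ) => (gaussDensity σ (p - q) : ℂ) *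
      (F x y * Complex.exp (-Complex.I * ((q * y / hbar : ℝ) : ℂ)))) (volume.prod volume) := by
    refine (hgI.norm.mul_prod (hF.integrable x).norm).mono' ?_ (ae_of_all _ fun z => ?_)
    · have := hF.continuous_right x
      refine Continuous.aestronglyMeasurable ?_
      simp only [Function.uncurry_def]
      fun_prop
    · simp only [Function.uncurry, norm_mul, norm_exp_neg_I_mul, mul_one]
      exact le_rfl
  have e2 : ∫ q, (gaussDensity σ (p - q) : ℂ) * partialFourier hbar F q x =
      ((1 / (2 * Real.pi * hbar) : ℝ) : ℂ) * ∫ y, F x y *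
        (((Real.sqrt (2 * Real.pi) * (hbar / σ) * gaussDensity (hbar / σ) y : ℝ) : ℂ) *
        Complex.exp (-Complex.I * ((p * y / hbar : ℝ) : ℂ))) := by
    simp only [partialFourier, mul_left_comm _ ((1 / (2 * Real.pi * hbar) : ℝ) : ℂ)]
    rw [integral_const_mul]
    congr 1
    simp_rw [← integral_const_mul]
    rw [integral_integral_swap hprod]
    congr 1 with y
    rw [← integral_gaussDensity_mul_exp hσ hb, ← integral_const_mul]
    congr 1 with q
    ring
  have e3 : ∫ y, F x y *
        (((Real.sqrt (2 * Real.pi) * (hbar / σ) * gaussDensity (hbar / σ) y : ℝ) : ℂ) *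
        Complex.exp (-Complex.I * ((p * y / hbar : ℝ) : ℂ))) =
      ((Real.sqrt (2 * Real.pi) * (hbar / σ) : ℝ) : ℂ) * ∫ z, F x (hbar / σ * z) *
        Complex.exp (-Complex.I * ((p / σ * z : ℝ) : ℂ)) ∂stdGauss := by
    have h := integral_gaussDensity_smul hτ (fun y => F x y *
      Complex.exp (-Complex.I * ((p * y / hbar : ℝ) : ℂ)))
    have hph : ∀ z : ℝ, p * (hbar / σ * z) / hbar = p / σ * z := fun z => by field_simp
    simp only [hph] at h
    rw [← h, ← integral_const_mul]
    congr 1 with y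
    rw [Complex.real_smul]
    push_cast
    ring
  have h2 : Real.sqrt (2 * Real.pi) * Real.sqrt (2 * Real.pi) = 2 * Real.pi :=
    Real.mul_self_sqrt (by positivity)
  rw [e1, e2, e3, Complex.re_ofReal_mul, Complex.re_ofReal_mul, ← mul_assoc]
  congr 1
  have h3 := sqrt_two_pi_pos.ne'
  generalize Real.sqrt (2 * Real.pi) = r at h2 h3
  rw [← h2]
  field_simp

/-- Convolution with a Gaussian of width `σp` in momentum is multiplication by a Gaussian of width
ℏ/σp in y; rescaling makes both Gaussians standard. No decay of the transform in p is required, so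
this also covers the momentum flow, whose kernel is only as regular in y as the mean force. -/
lemma smooth_re_partialFourier {σp σx : ℝ} (hp : 0 < σp) (hx : 0 < σx) (hb : 0 < hbar)
    (hF : QuadDecay F) (p x : ℝ) :
    smooth σp σx (fun p x => (partialFourier hbar F p x).re) p x =
      (Real.sqrt (2 * Real.pi) * σp)⁻¹ *
        (gaussSampling F σx (hbar / σp) (p / σp) x).re := by
  have hI := hF.integrable_sampling σx (hbar / σp) (p / σp) x
  have e : smooth σp σx (fun p x => (partialFourier hbar F p x).re) p x =
      ∫ u, gaussDensity σx u • ((Real.sqrt (2 * Real.pi) * σp)⁻¹ * (∫ z, F (x - u) (hbar / σp * z) *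
        Complex.exp (-Complex.I * ((p / σp * z : ℝ) : ℂ)) ∂stdGauss).re) := by
    unfold smooth
    rw [← integral_sub_left_eq_self _ volume x]
    congr 1 with u
    rw [← integral_gaussDensity_mul_partialFourier hp hb hF, smul_eq_mul, ← integral_const_mul]
    congr 1 with q
    rw [husimiKernel_eq, sub_sub_cancel]
    ring
  rw [e, integral_gaussDensity_smul hx, integral_const_mul, gaussSampling, integral_prod_symm _ hI]
  congr 1
  have := integral_re hI.integral_prod_right
  simpa only [RCLike.re_to_complex] using this

end relativePosition

/-! ### Growth of the potential -/

section potential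

variable {V : ℝ → ℝ}

/-- Mean value inequality on the ball of radius |x|; the degree rises by one. -/
lemma exists_growth_of_deriv_growth (hV : ContDiff ℝ 1 V)
    (hVg : ∃ (C : ℝ) (k : ℕ), ∀ x : ℝ, |deriv V x| ≤ C * (1 + |x|) ^ k) :
    ∃ (C : ℝ) (k : ℕ), 0 ≤ C ∧ ∀ x : ℝ, |V x| ≤ C * (1 + |x|) ^ k := by
  obtain ⟨C, k, hC⟩ := hVg
  have hC0 : 0 ≤ C := by simpa using (abs_nonneg _).trans (hC 0)
  refine ⟨|V 0| + C, k + 1, by positivity, fun x => ?_⟩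
  have h := (convex_closedBall (0 : ℝ) |x|).norm_image_sub_le_of_norm_deriv_le (f := V)
    (C := C * (1 + |x|) ^ k) (x := 0) (y := x)
    (fun z _ => hV.differentiable one_ne_zero z) (fun z hz => by
      refine (hC z).trans (mul_le_mul_of_nonneg_left (pow_le_pow_left₀ (by positivity) ?_ k) hC0)
      have : |z| ≤ |x| := by simpa using hz
      linarith) (by simp) (by simp)
  rw [sub_zero, Real.norm_eq_abs, Real.norm_eq_abs] at h
  have h1 : |V x| ≤ |V 0| + |V x - V 0| := by
    have := abs_add_le (V 0) (V x - V 0)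
    rwa [add_sub_cancel] at this
  have h2 : 1 ≤ (1 + |x|) ^ (k + 1) := one_le_pow₀ (by linarith [abs_nonneg x])
  have h3 : C * (1 + |x|) ^ k * |x| ≤ C * (1 + |x|) ^ (k + 1) := by
    rw [pow_succ, ← mul_assoc]
    exact mul_le_mul_of_nonneg_left (by linarith) (by positivity)
  nlinarith [abs_nonneg (V 0)]

lemma exists_quad_bound_potential_mul
    (hg : ∃ (C : ℝ) (k : ℕ), 0 ≤ C ∧ ∀ x : ℝ, |V x| ≤ C * (1 + |x|) ^ k)
    (ψ : SchwartzMap ℝ ℂ) : ∃ D, ∀ x, ‖(V x : ℂ) * ψ x‖ ≤ D * (1 + x ^ 2)⁻¹ := by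
  obtain ⟨C, k, hC0, hC⟩ := hg
  obtain ⟨D, hD⟩ := exists_polynomial_weight_bound k ψ
  refine ⟨C * D, fun x => ?_⟩
  rw [norm_mul, Complex.norm_real, Real.norm_eq_abs]
  calc |V x| * ‖ψ x‖ ≤ C * (1 + |x|) ^ k * ‖ψ x‖ := by gcongr; exact hC x
    _ = C * ((1 + |x|) ^ k * ‖ψ x‖) := by ring
    _ ≤ C * (D * (1 + x ^ 2)⁻¹) := mul_le_mul_of_nonneg_left (hD x) hC0
    _ = _ := by ring

end potential

section sampling

variable {F G : ℝ → ℝ → ℂ} {σ τ p x : ℝ}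

lemma gaussSampling_add_const_mul (hF : QuadDecay F) (hG : QuadDecay G) (c : ℂ) :
    gaussSampling (fun x y => F x y + c * G x y) σ τ p x =
      gaussSampling F σ τ p x + c * gaussSampling G σ τ p x := by
  unfold gaussSampling
  rw [← integral_const_mul, ← integral_add (hF.integrable_sampling σ τ p x)
    ((hG.integrable_sampling σ τ p x).const_mul c)]
  congr 1 with z
  ring

/-- The decay of `G` is a separate hypothesis because `F` has no spare factor of y. For the mean
force, `G` is a potential difference times ρ and inherits its decay from the growth of V. -/
lemma hasDerivAt_gaussSampling_momentum {hbar s : ℝ} (hb : 0 < hbar) (hs : 0 < s)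
    (hF : QuadDecay F) (hG : QuadDecay G) (h : ∀ x y, G x y = -Complex.I * (y / hbar : ℝ) * F x y) :
    HasDerivAt (fun p : ℝ => gaussSampling F σ (hbar / s) (p / s) x)
      (gaussSampling G σ (hbar / s) (p / s) x) p := by
  obtain ⟨C, hC⟩ := hG.bound
  have hC0 : 0 ≤ C := by simpa using (norm_nonneg _).trans (hC 0 0)
  refine (hasDerivAt_integral_of_dominated_loc_of_deriv_le (s := univ) (bound := fun _ => C)
    (F' := fun (p : ℝ) (z : ℝ × ℝ) => G (x - σ * z.2) (hbar / s * z.1) *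
      Complex.exp (-Complex.I * ((p / s * z.1 : ℝ) : ℂ))) univ_mem
    (Eventually.of_forall fun p => (hF.integrable_sampling _ _ _ _).aestronglyMeasurable)
    (hF.integrable_sampling _ _ _ _) (hG.integrable_sampling _ _ _ _).aestronglyMeasurable
    (ae_of_all _ fun z p _ => ?_) (integrable_const C) (ae_of_all _ fun z p _ => ?_)).2
  · rw [norm_mul, norm_exp_neg_I_mul, mul_one]
    refine (hC _ _).trans (mul_le_of_le_one_right hC0 (inv_le_one_of_one_le₀ ?_))
    nlinarith [sq_nonneg (hbar / s * z.1)]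
  · have h1 : HasDerivAt (fun p : ℝ => ((p / s * z.1 : ℝ) : ℂ)) ((z.1 / s : ℝ) : ℂ) p := by
      have : HasDerivAt (fun p : ℝ => p / s * z.1) (z.1 / s) p := by
        refine (((hasDerivAt_id p).div_const s).mul_const z.1).congr_deriv ?_
        ring
      exact this.ofReal_comp
    refine ((h1.const_mul (-Complex.I)).cexp.const_mul _).congr_deriv ?_
    rw [h, show hbar / s * z.1 / hbar = z.1 / s by field_simp]
    ring

end sampling

/-! ### Differentiation in time -/

section timeEvolution

variable {hbar m : ℝ} {V : ℝ → ℝ}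

/-- Seminorms are continuous, hence stay below their value at `t` plus one. This is where continuity
of the Schwartz-valued curve enters. -/
lemma eventually_seminorm_bound {ψ : ℝ → SchwartzMap ℝ ℂ} {t : ℝ} (h : ContinuousAt ψ t) (k n : ℕ) :
    ∃ B, ∀ᶠ s in 𝓝 t, ∀ x : ℝ, |x| ^ k * ‖iteratedDeriv n (ψ s) x‖ ≤ B := by
  have hc : Continuous (SchwartzMap.seminorm ℝ k n : SchwartzMap ℝ ℂ → ℝ) :=
    (schwartz_withSeminorms ℝ ℝ ℂ).continuous_seminorm (k, n)
  have h2 := hc.continuousAt.comp h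
  refine ⟨SchwartzMap.seminorm ℝ k n (ψ t) + 1, ?_⟩
  filter_upwards [h2.eventually (gt_mem_nhds (lt_add_one _))] with s hs x
  exact (SchwartzMap.le_seminorm' ℝ k n (ψ s) x).trans hs.le

lemma iteratedDeriv_two_eq_sderiv (ψ : SchwartzMap ℝ ℂ) (x : ℝ) :
    iteratedDeriv 2 ψ x = sderiv (sderiv ψ) x := by
  rw [iteratedDeriv_succ, iteratedDeriv_one, derivCLM_apply]
  congr 1

/-- The time derivative prescribed by the Schrödinger equation. -/
def timeDeriv (hbar m : ℝ) (V : ℝ → ℝ) (ψ : ℝ → ℂ) (x : ℝ) : ℂ :=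
  hamiltonian hbar m V ψ x / (Complex.I * (hbar : ℂ))

lemma continuous_timeDeriv (hV : Continuous V) (ψ : SchwartzMap ℝ ℂ) :
    Continuous (timeDeriv hbar m V ψ) := by
  unfold timeDeriv hamiltonian
  simp_rw [iteratedDeriv_two_eq_sderiv]
  fun_prop

lemma eventually_timeDeriv_bound
    (hg : ∃ (C : ℝ) (k : ℕ), 0 ≤ C ∧ ∀ x : ℝ, |V x| ≤ C * (1 + |x|) ^ k)
    {ψ : ℝ → SchwartzMap ℝ ℂ} {t : ℝ} (h : ContinuousAt ψ t) :
    ∃ B, ∀ᶠ s in 𝓝 t, ∀ x : ℝ, ‖ψ s x‖ ≤ B ∧ ‖timeDeriv hbar m V (ψ s) x‖ ≤ B := by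
  obtain ⟨C, k, hC0, hC⟩ := hg
  obtain ⟨B0, h0⟩ := eventually_seminorm_bound h 0 0
  obtain ⟨Bk, hk⟩ := eventually_seminorm_bound h k 0
  obtain ⟨B2, h2⟩ := eventually_seminorm_bound h 0 2
  set D := (|hbar ^ 2 / (2 * m)| * B2 + C * (2 ^ (k - 1) * (B0 + Bk))) / |hbar|
  refine ⟨max B0 D, ?_⟩
  filter_upwards [h0, hk, h2] with s h0 hk h2 x
  have h0 := h0 x
  have hk := hk x
  have h2 := h2 x
  simp only [pow_zero, one_mul, iteratedDeriv_zero] at h0 hk h2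
  refine ⟨h0.trans (le_max_left _ _), le_trans ?_ (le_max_right _ _)⟩
  rw [timeDeriv, norm_div, norm_mul, Complex.norm_I, one_mul, Complex.norm_real, Real.norm_eq_abs]
  refine div_le_div_of_nonneg_right ((norm_add_le _ _).trans (add_le_add ?_ ?_)) (abs_nonneg _)
  · rw [norm_mul, norm_neg, Complex.norm_real, Real.norm_eq_abs]
    exact mul_le_mul_of_nonneg_left h2 (abs_nonneg _)
  · rw [norm_mul, Complex.norm_real, Real.norm_eq_abs]
    have h3 : (1 + |x|) ^ k ≤ 2 ^ (k - 1) * (1 ^ k + |x| ^ k) :=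
      add_pow_le zero_le_one (abs_nonneg x) k
    rw [one_pow] at h3
    calc |V x| * ‖ψ s x‖ ≤ C * (2 ^ (k - 1) * (1 + |x| ^ k)) * ‖ψ s x‖ := by
          gcongr
          exact (hC x).trans (mul_le_mul_of_nonneg_left h3 hC0)
      _ = C * (2 ^ (k - 1) * (‖ψ s x‖ + |x| ^ k * ‖ψ s x‖)) := by ring
      _ ≤ _ := by gcongr

lemma hasDerivAt_gaussSampling_time (hV : Continuous V)
    (hg : ∃ (C : ℝ) (k : ℕ), 0 ≤ C ∧ ∀ x : ℝ, |V x| ≤ C * (1 + |x|) ^ k)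
    {I : Set ℝ} {ψ : ℝ → SchwartzMap ℝ ℂ} (hI : IsOpen I) (hψ : ContinuousOn ψ I)
    (hd : ∀ t ∈ I, ∀ x : ℝ, HasDerivAt (fun s : ℝ => ψ s x) (timeDeriv hbar m V (ψ t) x) t)
    {t : ℝ} (ht : t ∈ I) (σ τ p x : ℝ) :
    HasDerivAt (fun s => gaussSampling (crossDensity (ψ s) (ψ s)) σ τ p x)
      (gaussSampling (fun x y => crossDensity (timeDeriv hbar m V (ψ t)) (ψ t) x y +
        crossDensity (ψ t) (timeDeriv hbar m V (ψ t)) x y) σ τ p x) t := by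
  obtain ⟨B, hB⟩ := eventually_timeDeriv_bound (hbar := hbar) (m := m) hg
    (hψ.continuousAt (hI.mem_nhds ht))
  have hB0 : 0 ≤ B := (norm_nonneg _).trans (hB.self_of_nhds 0).1
  -- The sampling measure is a probability measure, so a constant majorant suffices: sup bounds on ψ
  -- and its time derivative near `t`.
  refine (hasDerivAt_integral_of_dominated_loc_of_deriv_le
    (s := {s | s ∈ I ∧ ∀ x : ℝ, ‖ψ s x‖ ≤ B ∧ ‖timeDeriv hbar m V (ψ s) x‖ ≤ B})
    (bound := fun _ => B * B + B * B)
    (F' := fun (s : ℝ) (z : ℝ × ℝ) =>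
      (crossDensity (timeDeriv hbar m V (ψ s)) (ψ s) (x - σ * z.2) (τ * z.1) +
        crossDensity (ψ s) (timeDeriv hbar m V (ψ s)) (x - σ * z.2) (τ * z.1)) *
      Complex.exp (-Complex.I * ((p * z.1 : ℝ) : ℂ)))
    (inter_mem (hI.mem_nhds ht) hB)
    (Eventually.of_forall fun s =>
      ((quadDecay_crossDensity _ _).integrable_sampling _ _ _ _).aestronglyMeasurable)
    ((quadDecay_crossDensity _ _).integrable_sampling _ _ _ _) ?_
    (ae_of_all _ fun z s hs => ?_) (integrable_const _) (ae_of_all _ fun z s hs => ?_)).2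
  · have hc := continuous_timeDeriv (hbar := hbar) (m := m) hV (ψ t)
    have h1 := continuous_crossDensity hc (ψ t).continuous
    have h2 := continuous_crossDensity (ψ t).continuous hc
    have h3 : Continuous fun z : ℝ × ℝ => (x - σ * z.2, τ * z.1) := by fun_prop
    exact (((h1.comp h3).add (h2.comp h3)).mul (by fun_prop)).aestronglyMeasurable
  · rw [norm_mul, norm_exp_neg_I_mul, mul_one]
    refine (norm_add_le _ _).trans (add_le_add ?_ ?_) <;>
    · rw [crossDensity, norm_mul, RCLike.norm_conj]
      first
      | exact mul_le_mul (hs.2 _).1 (hs.2 _).2 (norm_nonneg _) hB0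
      | exact mul_le_mul (hs.2 _).2 (hs.2 _).1 (norm_nonneg _) hB0
  · exact (((hd s hs.1 _).star).mul (hd s hs.1 _)).mul_const _

end timeEvolution

/-! ### The gauge potential and the Husimi flow in the Bohmian gauge -/

section gauge

variable {hbar m σp σx : ℝ} {V : ℝ → ℝ} (ψ : SchwartzMap ℝ ℂ)

/-- The first-moment density `p P(p,x)`. -/
def momentDensity (hbar : ℝ) (ψ : SchwartzMap ℝ ℂ) (p x : ℝ) : ℝ := p * wigner hbar ψ p x

/-- The position derivative of the first-moment density. -/
def momentDensityDx (hbar : ℝ) (ψ : SchwartzMap ℝ ℂ) (p x : ℝ) : ℝ := p * wignerDx hbar ψ p x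

lemma rapidDecay_momentDensity (hb : hbar ≠ 0) : RapidDecay (momentDensity hbar ψ) :=
  (rapidDecay_wigner hb ψ).momentum_mul

lemma rapidDecay_momentDensityDx (hb : hbar ≠ 0) : RapidDecay (momentDensityDx hbar ψ) :=
  (rapidDecay_wignerDx hb ψ).momentum_mul

lemma hasDerivAt_momentDensity (p x : ℝ) :
    HasDerivAt (momentDensity hbar ψ p) (momentDensityDx hbar ψ p x) x :=
  (hasDerivAt_wigner ψ p x).const_mul p

/-- The Gaussian average of the momentum marginal. -/
abbrev marginal (σ : ℝ) (f : ℝ → ℝ → ℝ) (x : ℝ) : ℝ := gaussAvg σ (fun _ => 1) f x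

lemma regBohmianMomentum_eq (hb : hbar ≠ 0) (hp : 0 < σp) (hx : 0 < σx) (x : ℝ) :
    regBohmianMomentum hbar σp σx ψ x =
      marginal σx (momentDensity hbar ψ) x / marginal σx (wigner hbar ψ) x := by
  unfold regBohmianMomentum smoothMomentum husimi
  rw [integral_smooth hp hx (rapidDecay_wigner hb ψ),
    integral_smooth hp hx (f := fun p x => p * wigner hbar ψ p x) (rapidDecay_momentDensity ψ hb)]
  rfl

lemma bohmianGauge_eq (hb : hbar ≠ 0) (hp : 0 < σp) (hx : 0 < σx) (p x : ℝ) :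
    bohmianGauge hbar m σp σx ψ p x = (1 / m) * (regBohmianMomentum hbar σp σx ψ x *
      gaussAvg σx (gaussCdf σp p) (wigner hbar ψ) x -
      gaussAvg σx (gaussCdf σp p) (momentDensity hbar ψ) x) := by
  unfold bohmianGauge smoothMomentum husimi
  rw [setIntegral_Iic_smooth hp hx (rapidDecay_wigner hb ψ),
    setIntegral_Iic_smooth hp hx (f := fun p x => p * wigner hbar ψ p x)
      (rapidDecay_momentDensity ψ hb)]
  rfl

lemma hasDerivAt_marginal {f g : ℝ → ℝ → ℝ} (hf : RapidDecay f) (hg : RapidDecay g)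
    (hd : ∀ p x, HasDerivAt (f p) (g p x) x) (σ x : ℝ) :
    HasDerivAt (marginal σ f) (marginal σ g x) x :=
  hasDerivAt_gaussAvg (linearGrowth_const 1) hf hg hd σ x

lemma hasDerivAt_regBohmianMomentum (hb : hbar ≠ 0) (hp : 0 < σp) (hx : 0 < σx) {x : ℝ}
    (hN : marginal σx (wigner hbar ψ) x ≠ 0) :
    HasDerivAt (regBohmianMomentum hbar σp σx ψ)
      ((marginal σx (momentDensityDx hbar ψ) x * marginal σx (wigner hbar ψ) x -
        marginal σx (momentDensity hbar ψ) x * marginal σx (wignerDx hbar ψ) x) /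
        marginal σx (wigner hbar ψ) x ^ 2) x := by
  rw [show regBohmianMomentum hbar σp σx ψ = fun x =>
    marginal σx (momentDensity hbar ψ) x / marginal σx (wigner hbar ψ) x from
      funext (regBohmianMomentum_eq ψ hb hp hx)]
  exact (hasDerivAt_marginal (rapidDecay_momentDensity ψ hb) (rapidDecay_momentDensityDx ψ hb)
    (hasDerivAt_momentDensity ψ) σx x).div (hasDerivAt_marginal (rapidDecay_wigner hb ψ)
      (rapidDecay_wignerDx hb ψ) (hasDerivAt_wigner ψ) σx x) hN

lemma integral_wigner (hb : 0 < hbar) (x : ℝ) : ∫ p, wigner hbar ψ p x = ‖ψ x‖ ^ 2 := by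
  have h := integral_crossWigner hb ψ ψ x
  simp_rw [← wigner_eq] at h
  rw [integral_complex_ofReal, Complex.conj_mul'] at h
  exact_mod_cast h

lemma marginal_wigner_eq (hb : 0 < hbar) (σ x : ℝ) :
    marginal σ (wigner hbar ψ) x = ∫ z, ‖ψ (x - σ * z)‖ ^ 2 ∂stdGauss := by
  rw [marginal, gaussAvg_eq_iterated (linearGrowth_const 1) (rapidDecay_wigner hb.ne' ψ)]
  simp only [one_mul, integral_wigner ψ hb]

lemma marginal_wigner_pos (hb : 0 < hbar) {σ : ℝ} (hσ : 0 < σ) {y : ℝ} (hy : ψ y ≠ 0) (x : ℝ) :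
    0 < marginal σ (wigner hbar ψ) x := by
  rw [marginal_wigner_eq ψ hb]
  have : (stdGauss : Measure ℝ).IsOpenPosMeasure :=
    (gaussianReal_absolutelyContinuous' 0 one_ne_zero).isOpenPosMeasure
  have hc : Continuous fun z => ‖ψ (x - σ * z)‖ ^ 2 := by fun_prop
  obtain ⟨C, -, hC⟩ := ψ.decay 0 0
  simp only [pow_zero, one_mul, norm_iteratedFDeriv_zero] at hC
  -- The Gaussian charges every open set, and at this point the argument x - σz equals `y`, where ψ
  -- does not vanish.
  refine integral_pos_of_integrable_nonneg_nonzero (x := (x - y) / σ) hc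
    ((integrable_const (C ^ 2)).mono' hc.aestronglyMeasurable (ae_of_all _ fun z => ?_))
    (fun z => by positivity) ?_
  · rw [Real.norm_eq_abs, abs_of_nonneg (by positivity)]
    exact pow_le_pow_left₀ (norm_nonneg _) (hC _) 2
  · rw [mul_div_cancel₀ _ hσ.ne', sub_sub_cancel]
    exact pow_ne_zero 2 (norm_ne_zero_iff.2 hy)

lemma exists_hasDerivAt_regBohmianMomentum (hb : 0 < hbar) (hp : 0 < σp) (hx : 0 < σx) (x : ℝ) :
    ∃ d, HasDerivAt (regBohmianMomentum hbar σp σx ψ) d x := by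
  by_cases h : ∃ y, ψ y ≠ 0
  · obtain ⟨y, hy⟩ := h
    exact ⟨_, hasDerivAt_regBohmianMomentum ψ hb.ne' hp hx (marginal_wigner_pos ψ hb hx hy x).ne'⟩
  -- For ψ = 0 the quotient is 0/0, which is 0 by convention, hence still differentiable.
  · push Not at h
    refine ⟨0, ?_⟩
    have : regBohmianMomentum hbar σp σx ψ = fun _ => 0 := by
      ext x
      rw [regBohmianMomentum_eq ψ hb.ne' hp hx, marginal_wigner_eq ψ hb]
      simp [h]
    rw [this]
    exact hasDerivAt_const x 0

lemma hasDerivAt_bohmianGauge_position (hb : hbar ≠ 0) (hp : 0 < σp) (hx : 0 < σx) {x d : ℝ}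
    (hd : HasDerivAt (regBohmianMomentum hbar σp σx ψ) d x) (p : ℝ) :
    HasDerivAt (fun x => bohmianGauge hbar m σp σx ψ p x) ((1 / m) *
      (d * gaussAvg σx (gaussCdf σp p) (wigner hbar ψ) x +
        regBohmianMomentum hbar σp σx ψ x * gaussAvg σx (gaussCdf σp p) (wignerDx hbar ψ) x -
        gaussAvg σx (gaussCdf σp p) (momentDensityDx hbar ψ) x)) x := by
  simp only [bohmianGauge_eq ψ hb hp hx]
  have hk := linearGrowth_gaussCdf hp p
  exact ((hd.mul (hasDerivAt_gaussAvg hk (rapidDecay_wigner hb ψ) (rapidDecay_wignerDx hb ψ)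
    (hasDerivAt_wigner ψ) σx x)).sub (hasDerivAt_gaussAvg hk (rapidDecay_momentDensity ψ hb)
      (rapidDecay_momentDensityDx ψ hb) (hasDerivAt_momentDensity ψ) σx x)).const_mul _

lemma husimiFlowX_eq (hb : 0 < hbar) (hm : 0 < m) (p x : ℝ) :
    husimiFlowX hbar m σp σx V ψ p x = (1 / m) * smoothMomentum hbar σp σx ψ p x := by
  unfold husimiFlowX smoothMomentum smooth
  simp_rw [wignerFlowX_eq hb hm, mul_assoc, integral_const_mul]

/-- The gauge is designed for this: ∂_p A subtracts the smoothed pP/m of the default flow and puts a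
velocity depending on x alone in its place. -/
lemma bohmianFlowX_eq (hb : 0 < hbar) (hm : 0 < m) (hp : 0 < σp) (hx : 0 < σx) (p x : ℝ) :
    bohmianFlowX hbar m σp σx V ψ p x =
      (1 / m) * (regBohmianMomentum hbar σp σx ψ x * husimi hbar σp σx ψ p x) := by
  have hd : HasDerivAt (fun p => bohmianGauge hbar m σp σx ψ p x)
      ((1 / m) * (regBohmianMomentum hbar σp σx ψ x * husimi hbar σp σx ψ p x -
        smoothMomentum hbar σp σx ψ p x)) p := by
    simp only [bohmianGauge_eq ψ hb.ne' hp hx]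
    exact (((hasDerivAt_gaussAvg_gaussCdf hp hx (rapidDecay_wigner hb.ne' ψ) p x).const_mul _).sub
      (hasDerivAt_gaussAvg_gaussCdf hp hx (rapidDecay_momentDensity ψ hb.ne') p x)).const_mul _
  rw [bohmianFlowX, hd.deriv, husimiFlowX_eq ψ hb hm]
  ring

lemma bohmianFlowP_eq (hb : hbar ≠ 0) (hp : 0 < σp) (hx : 0 < σx) {x d : ℝ}
    (hd : HasDerivAt (regBohmianMomentum hbar σp σx ψ) d x) (p : ℝ) :
    bohmianFlowP hbar m σp σx V ψ p x = husimiFlowP hbar m σp σx V ψ p x - (1 / m) *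
      (d * gaussAvg σx (gaussCdf σp p) (wigner hbar ψ) x +
        regBohmianMomentum hbar σp σx ψ x * gaussAvg σx (gaussCdf σp p) (wignerDx hbar ψ) x -
        gaussAvg σx (gaussCdf σp p) (momentDensityDx hbar ψ) x) := by
  rw [bohmianFlowP, (hasDerivAt_bohmianGauge_position ψ hb hp hx hd p).deriv]
  ring

lemma husimiFlowP_eq (hb : 0 < hbar) (hp : 0 < σp) (hx : 0 < σx) (hV : ContDiff ℝ 1 V)
    (hVg : ∃ (C : ℝ) (k : ℕ), ∀ x : ℝ, |deriv V x| ≤ C * (1 + |x|) ^ k) (p x : ℝ) :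
    husimiFlowP hbar m σp σx V ψ p x = -((Real.sqrt (2 * Real.pi) * σp)⁻¹ *
      (gaussSampling (fun x y => crossDensity ψ ψ x y * (forceMean V x y : ℂ)) σx (hbar / σp)
        (p / σp) x).re) := by
  rw [← smooth_re_partialFourier hp hx hb (quadDecay_crossDensity_mul_forceMean hV hVg ψ ψ)]
  unfold husimiFlowP smooth
  simp_rw [wignerFlowP_eq hb, neg_mul, integral_neg]

end gauge

/-! ### The continuity equation -/

section continuity

variable {hbar m σp σx : ℝ} {V : ℝ → ℝ}

/-- The potential part of the commutator with the Hamiltonian, on off-diagonal densities. -/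
def potentialCommutator (hbar : ℝ) (V : ℝ → ℝ) (ψ : SchwartzMap ℝ ℂ) (x y : ℝ) : ℂ :=
  -Complex.I / hbar * (crossDensity ψ (fun x => (V x : ℂ) * ψ x) x y -
    crossDensity (fun x => (V x : ℂ) * ψ x) ψ x y)

lemma quadDecay_potentialCommutator (hV : Continuous V)
    (hg : ∃ (C : ℝ) (k : ℕ), 0 ≤ C ∧ ∀ x : ℝ, |V x| ≤ C * (1 + |x|) ^ k) (ψ : SchwartzMap ℝ ℂ) :
    QuadDecay (potentialCommutator hbar V ψ) := by
  obtain ⟨C, hC⟩ := exists_quad_bound ψ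
  obtain ⟨D, hD⟩ := exists_quad_bound_potential_mul hg ψ
  have hc : Continuous fun x => (V x : ℂ) * ψ x := by fun_prop
  exact ((quadDecay_crossDensity_of_bound ψ.continuous hc hC hD).sub
    (quadDecay_crossDensity_of_bound hc ψ.continuous hD hC)).const_mul _

/-- The factor -iy/ℏ is what ∂_p produces under the Fourier transform, so the commutator is a
momentum derivative of the force term. -/
lemma potentialCommutator_eq (hb : hbar ≠ 0) (hV : ContDiff ℝ 1 V) (ψ : SchwartzMap ℝ ℂ) (x y : ℝ) :
    potentialCommutator hbar V ψ x y =
      -Complex.I * (y / hbar : ℝ) * (crossDensity ψ ψ x y * (forceMean V x y : ℂ)) := by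
  have h := congrArg (fun r : ℝ => (r : ℂ)) (mul_forceMean hV x y)
  have hc : (hbar : ℂ) ≠ 0 := by exact_mod_cast hb
  push_cast at h
  simp only [potentialCommutator, crossDensity, map_mul, Complex.conj_ofReal]
  push_cast
  linear_combination (Complex.I / hbar * starRingEnd ℂ (ψ (x - y / 2)) * ψ (x + y / 2)) * h

/-- The kernel whose Fourier transform is the position derivative of the first-moment density. -/
def momentKernel (hbar : ℝ) (ψ : SchwartzMap ℝ ℂ) (x y : ℝ) : ℂ :=
  -Complex.I * hbar / 2 *
    (crossDensity ψ (sderiv (sderiv ψ)) x y - crossDensity (sderiv (sderiv ψ)) ψ x y)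

lemma quadDecay_momentKernel (ψ : SchwartzMap ℝ ℂ) : QuadDecay (momentKernel hbar ψ) :=
  ((quadDecay_crossDensity _ _).sub (quadDecay_crossDensity _ _)).const_mul _

/-- The factor p moves onto the two terms of ∂_x P; the contributions with a derivative on each wave
function cancel and only second derivatives remain, as in the kinetic commutator. -/
lemma momentDensityDx_eq (hb : hbar ≠ 0) (ψ : SchwartzMap ℝ ℂ) (p x : ℝ) :
    momentDensityDx hbar ψ p x = (partialFourier hbar (momentKernel hbar ψ) p x).re := by
  have e : partialFourier hbar (momentKernel hbar ψ) p x = -Complex.I * hbar / 2 *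
      (crossWigner hbar ψ (sderiv (sderiv ψ)) p x -
        crossWigner hbar (sderiv (sderiv ψ)) ψ p x) := by
    simp only [crossWigner, partialFourier, ← mul_sub]
    rw [← integral_sub ((quadDecay_crossDensity _ _).integrable_mul_exp p x)
      ((quadDecay_crossDensity _ _).integrable_mul_exp p x),
      mul_left_comm (-Complex.I * hbar / 2 : ℂ), ← integral_const_mul (-Complex.I * hbar / 2 : ℂ)]
    congr 1
    congr 1 with y
    simp only [momentKernel]
    ring
  rw [momentDensityDx, wignerDx, e, ← Complex.add_re, ← Complex.re_ofReal_mul, mul_add,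
    momentum_mul_crossWigner hb, momentum_mul_crossWigner hb]
  congr 1
  ring

lemma conj_timeDeriv (ψ : ℝ → ℂ) (x : ℝ) : starRingEnd ℂ (timeDeriv hbar m V ψ x) =
    starRingEnd ℂ (hamiltonian hbar m V ψ x) / (-Complex.I * (hbar : ℂ)) := by
  simp [timeDeriv]

/-- The von Neumann equation for ρ(x,y), split into its potential and kinetic parts. -/
lemma crossDensity_timeDeriv (hb : hbar ≠ 0) (ψ : SchwartzMap ℝ ℂ) (x y : ℝ) :
    crossDensity (timeDeriv hbar m V ψ) ψ x y + crossDensity ψ (timeDeriv hbar m V ψ) x y =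
      potentialCommutator hbar V ψ x y + (-(1 / m) : ℝ) * momentKernel hbar ψ x y := by
  have hc : (hbar : ℂ) ≠ 0 := by exact_mod_cast hb
  simp only [crossDensity, conj_timeDeriv, potentialCommutator, momentKernel]
  simp only [timeDeriv, hamiltonian, iteratedDeriv_two_eq_sderiv, map_add, map_mul, map_neg,
    Complex.conj_ofReal]
  have hI : ∀ z : ℂ, z / (-Complex.I * hbar) = Complex.I / hbar * z := fun z => by
    rw [div_eq_iff (by simp [hb])]
    field_simp
    linear_combination z * Complex.I_sq
  have hI' : ∀ z : ℂ, z / (Complex.I * hbar) = -Complex.I / hbar * z := fun z => by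
    rw [div_eq_iff (by simp [hb])]
    field_simp
    linear_combination z * Complex.I_sq
  rw [hI, hI']
  push_cast
  rcases eq_or_ne m 0 with rfl | hm
  · simp
    ring
  have hmc : (m : ℂ) ≠ 0 := by exact_mod_cast hm
  field_simp
  ring

/-- The continuity equation of the flow in the regularized Bohmian gauge. -/
theorem continuity_equation (hb : 0 < hbar) (hm : 0 < m) (hV : ContDiff ℝ 1 V)
    (hVg : ∃ (C : ℝ) (k : ℕ), ∀ x : ℝ, |deriv V x| ≤ C * (1 + |x|) ^ k)
    {I : Set ℝ} {ψ : ℝ → SchwartzMap ℝ ℂ} (hI : IsOpen I) (hψ : ContinuousOn ψ I)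
    (hd : ∀ t ∈ I, ∀ x : ℝ, HasDerivAt (fun s : ℝ => ψ s x) (timeDeriv hbar m V (ψ t) x) t)
    (hp : 0 < σp) (hx : 0 < σx) {t : ℝ} (ht : t ∈ I) (p x : ℝ) :
    DifferentiableAt ℝ (fun s : ℝ => husimi hbar σp σx (ψ s) p x) t ∧
    DifferentiableAt ℝ (fun p' : ℝ => bohmianFlowP hbar m σp σx V (ψ t) p' x) p ∧
    DifferentiableAt ℝ (fun x' : ℝ => bohmianFlowX hbar m σp σx V (ψ t) p x') x ∧
    deriv (fun s : ℝ => husimi hbar σp σx (ψ s) p x) t =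
      -deriv (fun p' : ℝ => bohmianFlowP hbar m σp σx V (ψ t) p' x) p
      - deriv (fun x' : ℝ => bohmianFlowX hbar m σp σx V (ψ t) p x') x := by
  have hg := exists_growth_of_deriv_growth hV hVg
  have hb' := hb.ne'
  obtain ⟨d, hpB⟩ := exists_hasDerivAt_regBohmianMomentum (ψ t) hb hp hx x
  set c := (Real.sqrt (2 * Real.pi) * σp)⁻¹ with hc
  have hQ : ∀ s, husimi hbar σp σx (ψ s) p x =
      c * (gaussSampling (crossDensity (ψ s) (ψ s)) σx (hbar / σp) (p / σp) x).re := fun s => by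
    rw [← smooth_re_partialFourier hp hx hb (quadDecay_crossDensity _ _), husimi]
    congr 1
    ext p x
    exact wigner_eq_re (ψ s) p x
  have hQt : HasDerivAt (fun s => husimi hbar σp σx (ψ s) p x)
      (c * (gaussSampling (potentialCommutator hbar V (ψ t)) σx (hbar / σp) (p / σp) x).re -
        (1 / m) * smooth σp σx (momentDensityDx hbar (ψ t)) p x) t := by
    simp only [hQ]
    have h := hasDerivAt_gaussSampling_time hV.continuous hg hI hψ hd ht σx (hbar / σp) (p / σp) x
    have h2 := (Complex.reCLM.hasFDerivAt.comp_hasDerivAt t h).const_mul c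
    refine h2.congr_deriv ?_
    simp only [crossDensity_timeDeriv hb']
    rw [gaussSampling_add_const_mul (quadDecay_potentialCommutator hV.continuous hg _)
      (quadDecay_momentKernel _), Complex.reCLM_apply, Complex.add_re, Complex.re_ofReal_mul]
    have hM : smooth σp σx (momentDensityDx hbar (ψ t)) p x =
        c * (gaussSampling (momentKernel hbar (ψ t)) σx (hbar / σp) (p / σp) x).re := by
      rw [← smooth_re_partialFourier hp hx hb (quadDecay_momentKernel _)]
      congr 1
      ext p x
      exact momentDensityDx_eq hb' (ψ t) p x
    rw [hM]
    ring
  have hP : HasDerivAt (fun p => bohmianFlowP hbar m σp σx V (ψ t) p x)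
      (-(c * (gaussSampling (potentialCommutator hbar V (ψ t)) σx (hbar / σp) (p / σp) x).re) -
        (1 / m) * (d * husimi hbar σp σx (ψ t) p x + regBohmianMomentum hbar σp σx (ψ t) x *
          smooth σp σx (wignerDx hbar (ψ t)) p x -
          smooth σp σx (momentDensityDx hbar (ψ t)) p x)) p := by
    simp only [bohmianFlowP_eq (ψ t) hb' hp hx hpB, husimiFlowP_eq (ψ t) hb hp hx hV hVg]
    have h1 := hasDerivAt_gaussSampling_momentum (σ := σx) (p := p) (x := x) hb hp
      (quadDecay_crossDensity_mul_forceMean hV hVg (ψ t) (ψ t))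
      (quadDecay_potentialCommutator hV.continuous hg (ψ t)) (potentialCommutator_eq hb' hV (ψ t))
    have h2 := (Complex.reCLM.hasFDerivAt.comp_hasDerivAt p h1).const_mul c
    exact h2.neg.sub (((((hasDerivAt_gaussAvg_gaussCdf hp hx (rapidDecay_wigner hb' (ψ t))
      p x).const_mul d).add ((hasDerivAt_gaussAvg_gaussCdf hp hx (rapidDecay_wignerDx hb' (ψ t))
      p x).const_mul _)).sub (hasDerivAt_gaussAvg_gaussCdf hp hx
        (rapidDecay_momentDensityDx (ψ t) hb') p x)).const_mul _)
  have hX : HasDerivAt (fun x => bohmianFlowX hbar m σp σx V (ψ t) p x)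
      ((1 / m) * (d * husimi hbar σp σx (ψ t) p x + regBohmianMomentum hbar σp σx (ψ t) x *
          smooth σp σx (wignerDx hbar (ψ t)) p x)) x := by
    simp only [bohmianFlowX_eq (ψ t) hb hm hp hx]
    exact (hpB.mul (hasDerivAt_smooth_position hp hx (rapidDecay_wigner hb' (ψ t))
      (rapidDecay_wignerDx hb' (ψ t)) (hasDerivAt_wigner (ψ t)) p x)).const_mul _
  refine ⟨hQt.differentiableAt, hP.differentiableAt, hX.differentiableAt, ?_⟩
  -- The terms with the regularized Bohmian momentum and its derivative `d` occur with opposite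
  -- signs in the two flow derivatives.
  rw [hQt.deriv, hP.deriv, hX.deriv]
  ring

end continuity

/-! ### Momentum moments of the Wigner function -/

section moments

variable {hbar : ℝ} (ψ : SchwartzMap ℝ ℂ)

lemma integral_re_crossWigner (hb : 0 < hbar) (φ χ : SchwartzMap ℝ ℂ) (x : ℝ) :
    ∫ p, (crossWigner hbar φ χ p x).re = (φ x).re * (χ x).re + (φ x).im * (χ x).im := by
  have h := integral_re (integrable_crossWigner hb.ne' φ χ x)
  simp only [RCLike.re_to_complex] at h
  rw [h, integral_crossWigner hb]
  simp [Complex.mul_re]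

lemma integral_im_crossWigner (hb : 0 < hbar) (φ χ : SchwartzMap ℝ ℂ) (x : ℝ) :
    ∫ p, (crossWigner hbar φ χ p x).im = (φ x).re * (χ x).im - (φ x).im * (χ x).re := by
  have h := integral_im (integrable_crossWigner hb.ne' φ χ x)
  simp only [RCLike.im_to_complex] at h
  rw [h, integral_crossWigner hb]
  simp [Complex.mul_im]
  ring

lemma integrable_im_crossWigner (hb : 0 < hbar) (φ χ : SchwartzMap ℝ ℂ) (x : ℝ) :
    Integrable fun p => (crossWigner hbar φ χ p x).im :=
  (integrable_crossWigner hb.ne' φ χ x).im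

lemma integrable_re_crossWigner (hb : 0 < hbar) (φ χ : SchwartzMap ℝ ℂ) (x : ℝ) :
    Integrable fun p => (crossWigner hbar φ χ p x).re :=
  (integrable_crossWigner hb.ne' φ χ x).re

/-- The position density `|ψ|²`. -/
def density (ψ : SchwartzMap ℝ ℂ) (x : ℝ) : ℝ := (ψ x).re ^ 2 + (ψ x).im ^ 2

/-- The first derivative of `|ψ|²`. -/
def densityD1 (ψ : SchwartzMap ℝ ℂ) (x : ℝ) : ℝ :=
  2 * ((ψ x).re * (sderiv ψ x).re + (ψ x).im * (sderiv ψ x).im)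

/-- The second derivative of `|ψ|²`. -/
def densityD2 (ψ : SchwartzMap ℝ ℂ) (x : ℝ) : ℝ :=
  2 * ((sderiv ψ x).re ^ 2 + (sderiv ψ x).im ^ 2 +
    (ψ x).re * (sderiv (sderiv ψ) x).re + (ψ x).im * (sderiv (sderiv ψ) x).im)

/-- The third derivative of `|ψ|²`. -/
def densityD3 (ψ : SchwartzMap ℝ ℂ) (x : ℝ) : ℝ :=
  2 * (3 * ((sderiv ψ x).re * (sderiv (sderiv ψ) x).re + (sderiv ψ x).im *
    (sderiv (sderiv ψ) x).im) + (ψ x).re * (sderiv (sderiv (sderiv ψ)) x).re +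
    (ψ x).im * (sderiv (sderiv (sderiv ψ)) x).im)

/-- The momentum density `ℏ Im (ψ* ψ')`. -/
def momentumDensity (hbar : ℝ) (ψ : SchwartzMap ℝ ℂ) (x : ℝ) : ℝ :=
  hbar * ((ψ x).re * (sderiv ψ x).im - (ψ x).im * (sderiv ψ x).re)

/-- The derivative of the momentum density. -/
def momentumDensityD1 (hbar : ℝ) (ψ : SchwartzMap ℝ ℂ) (x : ℝ) : ℝ :=
  hbar * ((ψ x).re * (sderiv (sderiv ψ) x).im - (ψ x).im * (sderiv (sderiv ψ) x).re)

/-- The derivative of the second momentum moment of the Wigner function. -/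
def secondMomentD1 (hbar : ℝ) (ψ : SchwartzMap ℝ ℂ) (x : ℝ) : ℝ :=
  hbar ^ 2 / 2 * ((sderiv ψ x).re * (sderiv (sderiv ψ) x).re + (sderiv ψ x).im *
    (sderiv (sderiv ψ) x).im - (ψ x).re * (sderiv (sderiv (sderiv ψ)) x).re -
    (ψ x).im * (sderiv (sderiv (sderiv ψ)) x).im)

lemma norm_sq_eq_density (x : ℝ) : ‖ψ x‖ ^ 2 = density ψ x := by
  rw [← Complex.normSq_eq_norm_sq, Complex.normSq_apply, density]
  ring

lemma integral_wigner_eq_density (hb : 0 < hbar) (x : ℝ) :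
    ∫ p, wigner hbar ψ p x = density ψ x := by
  rw [integral_wigner ψ hb, norm_sq_eq_density]

lemma integral_wignerDx (hb : 0 < hbar) (x : ℝ) :
    ∫ p, wignerDx hbar ψ p x = densityD1 ψ x := by
  unfold wignerDx
  rw [integral_add (integrable_re_crossWigner hb _ _ x) (integrable_re_crossWigner hb _ _ x),
    integral_re_crossWigner hb, integral_re_crossWigner hb, densityD1]
  ring

lemma re_neg_I_mul (c : ℝ) (z : ℂ) : (-Complex.I * c / 2 * z).re = c / 2 * z.im := by
  rw [show -Complex.I * (c : ℂ) / 2 * z = ((c / 2 : ℝ) : ℂ) * (-Complex.I * z) by push_cast; ring,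
    Complex.re_ofReal_mul]
  simp

lemma momentDensity_eq (hb : hbar ≠ 0) (p x : ℝ) : momentDensity hbar ψ p x =
    hbar / 2 * ((crossWigner hbar ψ (sderiv ψ) p x).im -
      (crossWigner hbar (sderiv ψ) ψ p x).im) := by
  rw [momentDensity, wigner_eq_re, ← Complex.re_ofReal_mul, momentum_mul_crossWigner hb,
    re_neg_I_mul, Complex.sub_im]

lemma momentDensityDx_eq_im (hb : hbar ≠ 0) (p x : ℝ) : momentDensityDx hbar ψ p x =
    hbar / 2 * ((crossWigner hbar ψ (sderiv (sderiv ψ)) p x).im -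
      (crossWigner hbar (sderiv (sderiv ψ)) ψ p x).im) := by
  rw [momentDensityDx, wignerDx, ← Complex.add_re, ← Complex.re_ofReal_mul, mul_add,
    momentum_mul_crossWigner hb, momentum_mul_crossWigner hb, ← mul_add, re_neg_I_mul]
  simp only [Complex.add_im, Complex.sub_im]
  ring

lemma integral_momentDensity (hb : 0 < hbar) (x : ℝ) :
    ∫ p, momentDensity hbar ψ p x = momentumDensity hbar ψ x := by
  simp_rw [momentDensity_eq ψ hb.ne']
  rw [integral_const_mul, integral_sub (integrable_im_crossWigner hb _ _ x)
    (integrable_im_crossWigner hb _ _ x), integral_im_crossWigner hb, integral_im_crossWigner hb,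
    momentumDensity]
  ring

lemma integral_momentDensityDx (hb : 0 < hbar) (x : ℝ) :
    ∫ p, momentDensityDx hbar ψ p x = momentumDensityD1 hbar ψ x := by
  simp_rw [momentDensityDx_eq_im ψ hb.ne']
  rw [integral_const_mul, integral_sub (integrable_im_crossWigner hb _ _ x)
    (integrable_im_crossWigner hb _ _ x), integral_im_crossWigner hb, integral_im_crossWigner hb,
    momentumDensityD1]
  ring

lemma momentum_mul_im_crossWigner (hb : hbar ≠ 0) (φ χ : SchwartzMap ℝ ℂ) (p x : ℝ) :
    p * (crossWigner hbar φ χ p x).im = -(hbar / 2) * ((crossWigner hbar φ (sderiv χ) p x).re -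
      (crossWigner hbar (sderiv φ) χ p x).re) := by
  rw [← Complex.im_ofReal_mul, momentum_mul_crossWigner hb, ← Complex.sub_re]
  generalize crossWigner hbar φ (sderiv χ) p x - crossWigner hbar (sderiv φ) χ p x = z
  rw [show -Complex.I * (hbar : ℂ) / 2 * z = ((hbar / 2 : ℝ) : ℂ) * (-Complex.I * z) by
    push_cast; ring, Complex.im_ofReal_mul]
  simp

lemma integral_momentum_mul_momentDensityDx (hb : 0 < hbar) (x : ℝ) :
    ∫ p, p * momentDensityDx hbar ψ p x = secondMomentD1 hbar ψ x := by
  have e : ∀ p, p * momentDensityDx hbar ψ p x = -(hbar ^ 2 / 4) *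
      (((crossWigner hbar ψ (sderiv (sderiv (sderiv ψ))) p x).re -
        (crossWigner hbar (sderiv ψ) (sderiv (sderiv ψ)) p x).re) -
      ((crossWigner hbar (sderiv (sderiv ψ)) (sderiv ψ) p x).re -
        (crossWigner hbar (sderiv (sderiv (sderiv ψ))) ψ p x).re)) := fun p => by
    rw [momentDensityDx_eq_im ψ hb.ne', mul_left_comm, mul_sub, momentum_mul_im_crossWigner hb.ne',
      momentum_mul_im_crossWigner hb.ne']
    ring
  have hI := fun φ χ => integrable_re_crossWigner hb φ χ x
  have hS : ∀ φ χ φ' χ' : SchwartzMap ℝ ℂ, Integrable fun p =>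
      (crossWigner hbar φ χ p x).re - (crossWigner hbar φ' χ' p x).re :=
    fun φ χ φ' χ' => (hI φ χ).sub (hI φ' χ')
  simp_rw [e]
  rw [integral_const_mul, integral_sub (hS _ _ _ _) (hS _ _ _ _),
    integral_sub (hI _ _) (hI _ _), integral_sub (hI _ _) (hI _ _), integral_re_crossWigner hb,
    integral_re_crossWigner hb, integral_re_crossWigner hb, integral_re_crossWigner hb,
    secondMomentD1]
  ring

lemma integral_sub_mul {f : ℝ → ℝ → ℝ} (hf : RapidDecay f) (p x : ℝ) :
    ∫ q, (p - q) * f q x = p * (∫ q, f q x) - ∫ q, q * f q x := by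
  simp_rw [sub_mul]
  rw [integral_sub ((hf.integrable x).const_mul p) (hf.momentum_mul.integrable x),
    integral_const_mul]

end moments

/-! ### The quantum potential in terms of the density -/

section quantumPotential

variable {hbar m : ℝ} (ψ : SchwartzMap ℝ ℂ)

lemma hasDerivAt_re_schwartz (x : ℝ) : HasDerivAt (fun x => (ψ x).re) (sderiv ψ x).re x :=
  Complex.reCLM.hasFDerivAt.comp_hasDerivAt x (hasDerivAt_sderiv ψ x)

lemma hasDerivAt_im_schwartz (x : ℝ) : HasDerivAt (fun x => (ψ x).im) (sderiv ψ x).im x :=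
  Complex.imCLM.hasFDerivAt.comp_hasDerivAt x (hasDerivAt_sderiv ψ x)

lemma hasDerivAt_density (x : ℝ) : HasDerivAt (density ψ) (densityD1 ψ x) x := by
  refine (((hasDerivAt_re_schwartz ψ x).pow 2).add
    ((hasDerivAt_im_schwartz ψ x).pow 2)).congr_deriv ?_
  simp only [densityD1]
  push_cast
  ring

lemma hasDerivAt_densityD1 (x : ℝ) : HasDerivAt (densityD1 ψ) (densityD2 ψ x) x := by
  refine ((((hasDerivAt_re_schwartz ψ x).mul (hasDerivAt_re_schwartz (sderiv ψ) x)).add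
    ((hasDerivAt_im_schwartz ψ x).mul (hasDerivAt_im_schwartz (sderiv ψ) x))).const_mul
      2).congr_deriv ?_
  simp only [densityD2]
  ring

lemma hasDerivAt_densityD2 (x : ℝ) : HasDerivAt (densityD2 ψ) (densityD3 ψ x) x := by
  refine ((((((hasDerivAt_re_schwartz (sderiv ψ) x).pow 2).add
    ((hasDerivAt_im_schwartz (sderiv ψ) x).pow 2)).add ((hasDerivAt_re_schwartz ψ x).mul
      (hasDerivAt_re_schwartz (sderiv (sderiv ψ)) x))).add ((hasDerivAt_im_schwartz ψ x).mul
      (hasDerivAt_im_schwartz (sderiv (sderiv ψ)) x))).const_mul 2).congr_deriv ?_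
  simp only [densityD3]
  push_cast
  ring

lemma density_pos {x : ℝ} (h : ψ x ≠ 0) : 0 < density ψ x := by
  rw [← norm_sq_eq_density]; exact pow_pos (norm_pos_iff.2 h) 2

lemma hasDerivAt_norm_schwartz {x : ℝ} (h : ψ x ≠ 0) :
    HasDerivAt (fun z => ‖ψ z‖) (densityD1 ψ x / (2 * ‖ψ x‖)) x := by
  have e : (fun z => ‖ψ z‖) = fun z => Real.sqrt (density ψ z) := by
    ext z; rw [← norm_sq_eq_density, Real.sqrt_sq (norm_nonneg _)]
  have h2 := (hasDerivAt_density ψ x).sqrt (density_pos ψ h).ne'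
  rw [e]
  rwa [← norm_sq_eq_density, Real.sqrt_sq (norm_nonneg _)] at h2

lemma eventually_schwartz_ne_zero {x : ℝ} (h : ψ x ≠ 0) : ∀ᶠ z in 𝓝 x, ψ z ≠ 0 :=
  ψ.continuous.continuousAt.eventually_ne h

/-- Near a point with ψ ≠ 0 the modulus is the square root of the smooth positive density, so all
derivatives become rational in the density and its derivatives. -/
lemma quantumPotential_eq {x : ℝ} (h : ψ x ≠ 0) : quantumPotential hbar m ψ x =
    -(hbar ^ 2 / (2 * m)) * (densityD2 ψ x / (2 * density ψ x) -
      densityD1 ψ x ^ 2 / (4 * density ψ x ^ 2)) := by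
  have hR : ‖ψ x‖ ≠ 0 := norm_ne_zero_iff.2 h
  have h1 : deriv (fun z => ‖ψ z‖) =ᶠ[𝓝 x] fun z => densityD1 ψ z / (2 * ‖ψ z‖) :=
    (eventually_schwartz_ne_zero ψ h).mono fun z hz => (hasDerivAt_norm_schwartz ψ hz).deriv
  have h2 : HasDerivAt (fun z => densityD1 ψ z / (2 * ‖ψ z‖)) _ x :=
    (hasDerivAt_densityD1 ψ x).div ((hasDerivAt_norm_schwartz ψ h).const_mul 2) (by simpa using h)
  rw [quantumPotential, iteratedDeriv_succ, iteratedDeriv_one, h1.deriv_eq, h2.deriv, ← norm_sq_eq_density]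
  rcases eq_or_ne m 0 with rfl | hm
  · simp
  field_simp
  ring

lemma hasDerivAt_quantumPotential {x : ℝ} (h : ψ x ≠ 0) :
    HasDerivAt (quantumPotential hbar m ψ) (-(hbar ^ 2 / (2 * m)) *
      (densityD3 ψ x / (2 * density ψ x) - densityD1 ψ x * densityD2 ψ x / density ψ x ^ 2 +
        densityD1 ψ x ^ 3 / (2 * density ψ x ^ 3))) x := by
  have hn := (density_pos ψ h).ne'
  have h1 : quantumPotential hbar m ψ =ᶠ[𝓝 x] fun z => -(hbar ^ 2 / (2 * m)) *
      (densityD2 ψ z / (2 * density ψ z) - densityD1 ψ z ^ 2 / (4 * density ψ z ^ 2)) :=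
    (eventually_schwartz_ne_zero ψ h).mono fun z hz => quantumPotential_eq ψ hz
  refine HasDerivAt.congr_of_eventuallyEq ?_ h1
  have hd := hasDerivAt_density ψ x
  refine ((((hasDerivAt_densityD2 ψ x).div (hd.const_mul 2) (by simpa using hn)).sub
    (((hasDerivAt_densityD1 ψ x).pow 2).div ((hd.pow 2).const_mul 4)
      (by simpa using hn))).const_mul _).congr_deriv ?_
  simp only [Pi.pow_apply]
  push_cast
  field_simp
  ring

lemma bohmianMomentum_eq {x : ℝ} (h : ψ x ≠ 0) :
    bohmianMomentum hbar ψ x = momentumDensity hbar ψ x / density ψ x := by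
  have hn := (density_pos ψ h).ne'
  rw [bohmianMomentum, ← derivCLM_apply ℂ ψ x, Complex.div_re]
  have e : Complex.normSq (ψ x) = density ψ x := by rw [Complex.normSq_apply, density]; ring
  rw [e, momentumDensity, ← add_div]
  congr 1
  simp
  ring

/-- The divergence of the momentum dispersion is the quantum force. -/
lemma quantum_force_identity (hm : m ≠ 0) {x : ℝ} (h : ψ x ≠ 0) (p v : ℝ) :
    (-(density ψ x * v) - 1 / m *
      ((momentumDensityD1 hbar ψ x * density ψ x - momentumDensity hbar ψ x * densityD1 ψ x) /
        density ψ x ^ 2 * (p * density ψ x - momentumDensity hbar ψ x) +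
      momentumDensity hbar ψ x / density ψ x * (p * densityD1 ψ x - momentumDensityD1 hbar ψ x) -
      (p * momentumDensityD1 hbar ψ x - secondMomentD1 hbar ψ x))) / density ψ x =
    -(v + -(hbar ^ 2 / (2 * m)) *
      (densityD3 ψ x / (2 * density ψ x) - densityD1 ψ x * densityD2 ψ x / density ψ x ^ 2 +
        densityD1 ψ x ^ 3 / (2 * density ψ x ^ 3))) := by
  have hn := (density_pos ψ h).ne'
  have hd : density ψ x = (ψ x).re ^ 2 + (ψ x).im ^ 2 := rfl
  simp only [densityD1, densityD2, densityD3, momentumDensity, momentumDensityD1, secondMomentD1]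
  -- The density stays an atom while denominators are cleared; expanding it afterwards leaves a
  -- polynomial identity in the real and imaginary parts of ψ and its derivatives, from which p
  -- drops out.
  generalize density ψ x = n at hn hd ⊢
  field_simp
  rw [hd]
  ring

end quantumPotential

/-! ### The singular limit of the flow -/

section singularLimit

variable {hbar m : ℝ} {V : ℝ → ℝ} (ψ : SchwartzMap ℝ ℂ)

lemma tendsto_gaussSampling {ι : Type*} {l : Filter ι} [l.IsCountablyGenerated] {F : ℝ → ℝ → ℂ}
    (hF : QuadDecay F) {σ τ r : ι → ℝ} (hσ : Tendsto σ l (𝓝 0)) (hτ : Tendsto τ l (𝓝 0))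
    (hr : Tendsto r l (𝓝 0)) (x : ℝ) :
    Tendsto (fun i => gaussSampling F (σ i) (τ i) (r i) x) l (𝓝 (F x 0)) := by
  obtain ⟨C, hC⟩ := hF.bound
  have hC0 : 0 ≤ C := by simpa using (norm_nonneg _).trans (hC 0 0)
  have e : F x 0 = ∫ _ : ℝ × ℝ, F x 0 ∂(stdGauss.prod stdGauss) := by simp
  rw [e]
  refine tendsto_integral_filter_of_dominated_convergence (fun _ => C)
    (Eventually.of_forall fun i => (hF.integrable_sampling _ _ _ _).aestronglyMeasurable)
    (Eventually.of_forall fun i => ae_of_all _ fun z => ?_) (integrable_const C)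
    (ae_of_all _ fun z => ?_)
  · rw [norm_mul, norm_exp_neg_I_mul, mul_one]
    refine (hC _ _).trans (mul_le_of_le_one_right hC0 (inv_le_one_of_one_le₀ ?_))
    nlinarith [sq_nonneg (τ i * z.1)]
  · have h1 : Tendsto (fun i => (x - σ i * z.2, τ i * z.1)) l (𝓝 (x, 0)) := by
      refine Tendsto.prodMk_nhds ?_ (by simpa using hτ.mul_const z.1)
      simpa using tendsto_const_nhds.sub (hσ.mul_const z.2) (a := x)
    have h2 : Tendsto (fun i => Complex.exp (-Complex.I * ((r i * z.1 : ℝ) : ℂ))) l (𝓝 1) := by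
      have hc : Continuous fun s : ℝ => Complex.exp (-Complex.I * ((s * z.1 : ℝ) : ℂ)) := by
        fun_prop
      simpa [Function.comp_def] using (hc.tendsto 0).comp hr
    simpa using ((hF.cont.tendsto (x, 0)).comp h1).mul h2

lemma tendsto_scaled_husimi (hb : 0 < hbar) (p x : ℝ) :
    Tendsto (fun σ : ℝ × ℝ => Real.sqrt (2 * Real.pi) * σ.1 * husimi hbar σ.1 σ.2 ψ p x)
      bohmianLimit (𝓝 (density ψ x)) := by
  rw [← integral_wigner_eq_density ψ hb]
  exact tendsto_scaled_smooth (rapidDecay_wigner hb.ne' ψ) p x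

lemma eventually_husimi_ne_zero (hb : 0 < hbar) (p : ℝ) {x : ℝ} (h : ψ x ≠ 0) :
    ∀ᶠ σ : ℝ × ℝ in bohmianLimit, husimi hbar σ.1 σ.2 ψ p x ≠ 0 := by
  filter_upwards [(tendsto_scaled_husimi ψ hb p x).eventually_ne (density_pos ψ h).ne'] with σ hσ h0
  exact hσ (by rw [h0, mul_zero])

lemma tendsto_regBohmianMomentum (hb : 0 < hbar) {x : ℝ} (h : ψ x ≠ 0) :
    Tendsto (fun σ : ℝ × ℝ => regBohmianMomentum hbar σ.1 σ.2 ψ x) bohmianLimit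
      (𝓝 (momentumDensity hbar ψ x / density ψ x)) := by
  have h1 := tendsto_gaussAvg_one (rapidDecay_momentDensity ψ hb.ne') x
  have h2 := tendsto_gaussAvg_one (rapidDecay_wigner hb.ne' ψ) x
  rw [integral_momentDensity ψ hb] at h1
  rw [integral_wigner_eq_density ψ hb] at h2
  refine (h1.div h2 (density_pos ψ h).ne').congr' ?_
  filter_upwards [bohmianLimit_pos] with σ hσ
  exact (regBohmianMomentum_eq ψ hb.ne' hσ.1 hσ.2 x).symm

/-- Both ℏ/σp and p/σp tend to 0, so the sampling collapses to y = 0, where the mean force is V'(x).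
The default gauge thus contributes the classical force only. -/
lemma tendsto_scaled_husimiFlowP (hb : 0 < hbar) (hV : ContDiff ℝ 1 V)
    (hVg : ∃ (C : ℝ) (k : ℕ), ∀ x : ℝ, |deriv V x| ≤ C * (1 + |x|) ^ k) (p x : ℝ) :
    Tendsto (fun σ : ℝ × ℝ => Real.sqrt (2 * Real.pi) * σ.1 *
      husimiFlowP hbar m σ.1 σ.2 V ψ p x) bohmianLimit (𝓝 (-(density ψ x * deriv V x))) := by
  have hlim : ∀ c : ℝ, Tendsto (fun σ : ℝ × ℝ => c / σ.1) bohmianLimit (𝓝 0) := fun c =>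
    tendsto_fst_bohmianLimit.const_div_atTop c
  have h := tendsto_gaussSampling (quadDecay_crossDensity_mul_forceMean hV hVg ψ ψ)
    tendsto_snd_bohmianLimit (hlim hbar) (hlim p) x
  have h2 := ((Complex.continuous_re.tendsto _).comp h).neg
  have e : (crossDensity ψ ψ x 0 * (forceMean V x 0 : ℂ)).re = density ψ x * deriv V x := by
    rw [forceMean_zero, Complex.re_mul_ofReal]
    congr 1
    simp only [crossDensity, zero_div, sub_zero, add_zero, Complex.mul_re, Complex.conj_re,
      Complex.conj_im, density]
    ring
  rw [e] at h2
  refine h2.congr' ?_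
  filter_upwards [bohmianLimit_pos] with σ hσ
  have hc : Real.sqrt (2 * Real.pi) * σ.1 ≠ 0 := (mul_pos sqrt_two_pi_pos hσ.1).ne'
  rw [husimiFlowP_eq ψ hb hσ.1 hσ.2 hV hVg, mul_neg, mul_inv_cancel_left₀ hc]
  rfl

/-- The gauge term is of the same order as Q only because its leading part, from the constant 1/2 in
`gaussCdf`, vanishes identically; the `scaledErf` part then turns into moments with weight p - q. -/
lemma tendsto_scaled_bohmianFlowP (hb : 0 < hbar) (hV : ContDiff ℝ 1 V)
    (hVg : ∃ (C : ℝ) (k : ℕ), ∀ x : ℝ, |deriv V x| ≤ C * (1 + |x|) ^ k) (p : ℝ) {x : ℝ}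
    (h : ψ x ≠ 0) :
    Tendsto (fun σ : ℝ × ℝ => Real.sqrt (2 * Real.pi) * σ.1 *
      bohmianFlowP hbar m σ.1 σ.2 V ψ p x) bohmianLimit
      (𝓝 (-(density ψ x * deriv V x) - 1 / m *
      ((momentumDensityD1 hbar ψ x * density ψ x - momentumDensity hbar ψ x * densityD1 ψ x) /
        density ψ x ^ 2 * (p * density ψ x - momentumDensity hbar ψ x) +
      momentumDensity hbar ψ x / density ψ x * (p * densityD1 ψ x - momentumDensityD1 hbar ψ x) -
      (p * momentumDensityD1 hbar ψ x - secondMomentD1 hbar ψ x)))) := by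
  have hb' := hb.ne'
  have rP := rapidDecay_wigner hb' ψ
  have rPx := rapidDecay_wignerDx hb' ψ
  have rM := rapidDecay_momentDensity ψ hb'
  have rMx := rapidDecay_momentDensityDx ψ hb'
  have nP := tendsto_gaussAvg_one rP x
  have nPx := tendsto_gaussAvg_one rPx x
  have nM := tendsto_gaussAvg_one rM x
  have nMx := tendsto_gaussAvg_one rMx x
  rw [integral_wigner_eq_density ψ hb] at nP
  rw [integral_wignerDx ψ hb] at nPx
  rw [integral_momentDensity ψ hb] at nM
  rw [integral_momentDensityDx ψ hb] at nMx
  have eP := tendsto_gaussAvg_scaledErf rP p x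
  have ePx := tendsto_gaussAvg_scaledErf rPx p x
  have eMx := tendsto_gaussAvg_scaledErf rMx p x
  have i1 : ∫ q, q * wigner hbar ψ q x = momentumDensity hbar ψ x := integral_momentDensity ψ hb x
  have i2 : ∫ q, q * wignerDx hbar ψ q x = momentumDensityD1 hbar ψ x :=
    integral_momentDensityDx ψ hb x
  rw [integral_sub_mul rP, integral_wigner_eq_density ψ hb, i1] at eP
  rw [integral_sub_mul rPx, integral_wignerDx ψ hb, i2] at ePx
  rw [integral_sub_mul rMx, integral_momentDensityDx ψ hb,
    integral_momentum_mul_momentDensityDx ψ hb] at eMx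
  have hn := (density_pos ψ h).ne'
  have hd := ((nMx.mul nP).sub (nM.mul nPx)).div (nP.pow 2) (pow_ne_zero 2 hn)
  refine ((tendsto_scaled_husimiFlowP (m := m) ψ hb hV hVg p x).sub
    ((((hd.mul eP).add ((nM.div nP hn).mul ePx)).sub eMx).const_mul (1 / m))).congr' ?_
  filter_upwards [bohmianLimit_pos] with σ hσ
  have hN := (marginal_wigner_pos ψ hb hσ.2 h x).ne'
  have hc : Real.sqrt (2 * Real.pi) * σ.1 ≠ 0 := (mul_pos sqrt_two_pi_pos hσ.1).ne'
  rw [bohmianFlowP_eq ψ hb' hσ.1 hσ.2 (hasDerivAt_regBohmianMomentum ψ hb' hσ.1 hσ.2 hN) p,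
    regBohmianMomentum_eq ψ hb' hσ.1 hσ.2, gaussAvg_gaussCdf hσ.1 rP, gaussAvg_gaussCdf hσ.1 rPx,
    gaussAvg_gaussCdf hσ.1 rMx]
  simp only [Pi.div_apply, marginal] at hN ⊢
  generalize Real.sqrt (2 * Real.pi) * σ.1 = c at hc ⊢
  generalize gaussAvg σ.2 (fun _ => 1) (wigner hbar ψ) x = a at hN ⊢
  -- The terms with 1/2 cancel here: they add up to the derivative of (quotient of marginals) ×
  -- (density marginal) minus that of the momentum marginal.
  field_simp
  ring

/-- The flow in the singular limit. -/
theorem singular_limit (hb : 0 < hbar) (hm : 0 < m) (hV : ContDiff ℝ 1 V)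
    (hVg : ∃ (C : ℝ) (k : ℕ), ∀ x : ℝ, |deriv V x| ≤ C * (1 + |x|) ^ k) (p : ℝ) {x : ℝ}
    (h : ψ x ≠ 0) :
    Tendsto (fun σ : ℝ × ℝ => Real.sqrt (2 * Real.pi) * σ.1 * husimi hbar σ.1 σ.2 ψ p x)
        bohmianLimit (𝓝 (‖ψ x‖ ^ 2)) ∧
      Tendsto (fun σ : ℝ × ℝ => regBohmianMomentum hbar σ.1 σ.2 ψ x)
        bohmianLimit (𝓝 (bohmianMomentum hbar ψ x)) ∧
      Tendsto (fun σ : ℝ × ℝ =>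
          bohmianFlowX hbar m σ.1 σ.2 V ψ p x / husimi hbar σ.1 σ.2 ψ p x)
        bohmianLimit (𝓝 (bohmianMomentum hbar ψ x / m)) ∧
      Tendsto (fun σ : ℝ × ℝ =>
          bohmianFlowP hbar m σ.1 σ.2 V ψ p x / husimi hbar σ.1 σ.2 ψ p x)
        bohmianLimit (𝓝 (-deriv (fun z : ℝ => V z + quantumPotential hbar m ψ z) x)) := by
  have hQ := tendsto_scaled_husimi ψ hb p x
  have hpB := tendsto_regBohmianMomentum ψ hb h
  rw [← bohmianMomentum_eq ψ h] at hpB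
  have hn := (density_pos ψ h).ne'
  refine ⟨by rwa [norm_sq_eq_density], hpB, ?_, ?_⟩
  · refine (hpB.div_const m).congr' ?_
    filter_upwards [bohmianLimit_pos, eventually_husimi_ne_zero ψ hb p h] with σ hσ hσQ
    rw [bohmianFlowX_eq ψ hb hm hσ.1 hσ.2]
    field_simp
  · have hdV : HasDerivAt (fun z => V z + quantumPotential hbar m ψ z) _ x :=
      (hV.differentiable one_ne_zero x).hasDerivAt.add (hasDerivAt_quantumPotential ψ h)
    rw [hdV.deriv, ← quantum_force_identity ψ hm.ne' h p]
    refine ((tendsto_scaled_bohmianFlowP ψ hb hV hVg p h).div hQ hn).congr' ?_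
    filter_upwards [bohmianLimit_pos] with σ hσ
    exact mul_div_mul_left _ _ (mul_pos sqrt_two_pi_pos hσ.1).ne'

end singularLimit

end HusimiFluid

end

theorem theorem3 (hbar m : ℝ) (hhbar : 0 < hbar) (hm : 0 < m)
    (V : ℝ → ℝ) (hV : ContDiff ℝ 1 V)
    (hVgrowth : ∃ (C : ℝ) (k : ℕ), ∀ x : ℝ, |deriv V x| ≤ C * (1 + |x|) ^ k) :
    -- the gauge flow represents the evolution of the fluid, for all positive widths
    (∀ (I : Set ℝ) (ψ : ℝ → SchwartzMap ℝ ℂ), IsOpen I → ContinuousOn ψ I →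
      (∀ t ∈ I, ∀ x : ℝ, HasDerivAt (fun s : ℝ => ψ s x)
        (hamiltonian hbar m V (ψ t) x / (Complex.I * (hbar : ℂ))) t) →
      ∀ σp σx : ℝ, 0 < σp → 0 < σx → ∀ t ∈ I, ∀ p x : ℝ,
        DifferentiableAt ℝ (fun s : ℝ => husimi hbar σp σx (ψ s) p x) t ∧
        DifferentiableAt ℝ (fun p' : ℝ => bohmianFlowP hbar m σp σx V (ψ t) p' x) p ∧
        DifferentiableAt ℝ (fun x' : ℝ => bohmianFlowX hbar m σp σx V (ψ t) p x') x ∧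
        deriv (fun s : ℝ => husimi hbar σp σx (ψ s) p x) t =
          -deriv (fun p' : ℝ => bohmianFlowP hbar m σp σx V (ψ t) p' x) p
          - deriv (fun x' : ℝ => bohmianFlowX hbar m σp σx V (ψ t) p x') x) ∧
    -- the flow in the singular limit
    (∀ (ψ : SchwartzMap ℝ ℂ) (p x : ℝ), ψ x ≠ 0 →
      Tendsto (fun σ : ℝ × ℝ => Real.sqrt (2 * Real.pi) * σ.1 * husimi hbar σ.1 σ.2 ψ p x)
        bohmianLimit (𝓝 (‖ψ x‖ ^ 2)) ∧
      Tendsto (fun σ : ℝ × ℝ => regBohmianMomentum hbar σ.1 σ.2 ψ x)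
        bohmianLimit (𝓝 (bohmianMomentum hbar ψ x)) ∧
      Tendsto (fun σ : ℝ × ℝ =>
          bohmianFlowX hbar m σ.1 σ.2 V ψ p x / husimi hbar σ.1 σ.2 ψ p x)
        bohmianLimit (𝓝 (bohmianMomentum hbar ψ x / m)) ∧
      Tendsto (fun σ : ℝ × ℝ =>
          bohmianFlowP hbar m σ.1 σ.2 V ψ p x / husimi hbar σ.1 σ.2 ψ p x)
        bohmianLimit (𝓝 (-deriv (fun z : ℝ => V z + quantumPotential hbar m ψ z) x))) := by
  refine ⟨fun I ψ hI hψ hd σp σx hp hx t ht p x => ?_, fun ψ p x h => ?_⟩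
  · exact continuity_equation hhbar hm hV hVgrowth hI hψ hd hp hx ht p x
  · exact singular_limit ψ hhbar hm hV hVgrowth p h
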